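/- Let $d\ge 1$, let $\mathcal X\subset\mathbb R^d$ be nonempty and compact, and let $\eta>0$. Let $\mathcal F$ be the set of functions $f:\mathcal X\to\mathbb R$ that are Lipschitz with respect to $\|\cdot\|_1$, with seminorm $\|f\|_{\mathcal F}=\sup_{x\ne y\in\mathcal X}|f(x)-f(y)|/\|x-y\|_1$. For probability measures $P,Q$ on $\mathcal X$ let $\gamma_{\mathcal F}(P,Q)=\sup\{|\mathbb E_P f-\mathbb E_Q f| : f\in\mathcal F,\ \|f\|_{\mathcal F}\le 1\}$, and let $D=\sup_{P,Q}\gamma_{\mathcal F}(P,Q)$. Let $\sigma(x)=\langle\bar\sigma,x\rangle$, where $\bar\sigma\in\mathbb R^d$ has i.i.d. entries with distribution function $1-e^{-s/\eta}$ for $s\ge 0$ (the law $\mathrm{Exp}(\eta)$, with mean $\eta$). Write $H_d=\sum_{k=1}^d 1/k$. There are universal constants $C,c_1,c_2,c_3>0$, independent of all the other data, such that the following hold. (1) For every $f\in\mathcal F$, almost surely $f-\sigma$ has a unique minimizer over $\mathcal X$, and there is a measurable choice $x_f(\sigma)$ of it. Let $\nabla\Phi(f)$ be the law of $x_f(\sigma)$.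 (2) $\|\sigma\|_{\mathcal F}$ is integrable and $\mathbb E\|\sigma\|_{\mathcal F}\le \eta H_d$, with equality if for every $i$ the set $\mathcal X$ contains two distinct points that differ only in coordinate $i$ (for instance if $\mathcal X$ has nonempty interior). Here $\log d\le H_d\le 1+\log d$. (3) $\gamma_{\mathcal F}(\nabla\Phi(f),\nabla\Phi(g))\le C\,\frac{d^2D}{\eta}\,\|f-g\|_{\mathcal F}$ for all $f,g\in\mathcal F$. (4) Consider $T$ rounds of optimistic follow-the-perturbed-leader. In round $t=1,\dots,T$ there are a guess $g_t\in\mathcal F$ and a loss $f_t\in\mathcal F$ (both may be random and may depend on everything that happened in earlier rounds). Vectors $\bar\sigma_{t,1},\dots,\bar\sigma_{t,m}$ are drawn independently with the law of $\bar\sigma$, independently of $f_t$, $g_t$ and the past. The learner computes minimizers $x_{t,j}$ of $\sum_{s<t}f_s+g_t-\langle\bar\sigma_{t,j},\cdot\rangle$ over $\mathcal X$ and plays a sample $x_t$ from the empirical distribution $P_t$ of $x_{t,1},\dots,x_{t,m}$, drawn with independent randomness. Let $\tilde P_{t-1}$ be the empirical distribution obtained in round $t$ if $g_t$ is replaced by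 $0$, and let $P_t^\infty=\mathbb E[P_t\mid g_t,f_{1:t-1},P_{1:t-1}]$ and $\tilde P_{t-1}^\infty=\mathbb E[\tilde P_{t-1}\mid f_{1:t-1},P_{1:t-1}]$. If $\mathbb E\|f_t\|_{\mathcal F}<\infty$ and $\mathbb E\|f_t-g_t\|_{\mathcal F}^2<\infty$ for all $t$, then the expectations below exist and $$\sup_{x\in\mathcal X}\mathbb E\Big[\sum_{t=1}^T f_t(x_t)-f_t(x)\Big]\le c_1\,\eta D(1+\log d)+c_2\sum_{t=1}^T\frac{d^2D}{\eta}\,\mathbb E\|f_t-g_t\|_{\mathcal F}^2-c_3\sum_{t=1}^T\frac{\eta}{d^2D}\,\mathbb E\,\gamma_{\mathcal F}(P_t^\infty,\tilde P_{t-1}^\infty)^2 ,$$ where the last sum is read as $0$ if $D=0$. If $d\ge 2$, the same bound holds with $\log d$ in place of $1+\log d$. -/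

import Mathlib

open MeasureTheory ProbabilityTheory

namespace OFTPL

noncomputable section

/-- The `ℓ¹` distance `‖x - y‖₁` on `ℝ^d`. -/
def l1Dist {d : ℕ} (x y : Fin d → ℝ) : ℝ := ∑ i, |x i - y i|

/-- The class `𝓕` of real functions on `X` that are Lipschitz with respect to the `ℓ¹` norm. -/
def lipClass {d : ℕ} (X : Set (Fin d → ℝ)) : Set (X → ℝ) :=
  {f | ∃ K : ℝ, ∀ x y : X, |f x - f y| ≤ K * l1Dist (x : Fin d → ℝ) y}

/-- The Lipschitz seminorm `‖f‖_𝓕 = sup_{x ≠ y} |f x - f y| / ‖x - y‖₁`. -/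
def lipSemi {d : ℕ} {X : Set (Fin d → ℝ)} (f : X → ℝ) : ℝ :=
  sSup {r | ∃ x y : X, x ≠ y ∧ r = |f x - f y| / l1Dist (x : Fin d → ℝ) y}

/-- The integral probability metric `γ_𝓕(P, Q)` induced by `(𝓕, ‖·‖_𝓕)`. -/
def ipm {d : ℕ} {X : Set (Fin d → ℝ)} (P Q : Measure X) : ℝ :=
  sSup {r | ∃ f ∈ lipClass X, lipSemi f ≤ 1 ∧ r = |∫ x, f x ∂P - ∫ x, f x ∂Q|}

/-- The diameter `D` of the set of all probability distributions on `X` with respect to `γ_𝓕`. -/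
def diam {d : ℕ} (X : Set (Fin d → ℝ)) : ℝ :=
  sSup {r | ∃ P Q : Measure X, IsProbabilityMeasure P ∧ IsProbabilityMeasure Q ∧ r = ipm P Q}

/-- The linear perturbation function `x ↦ ⟨s, x⟩` on `X`. -/
def linPert {d : ℕ} (X : Set (Fin d → ℝ)) (s : Fin d → ℝ) : X → ℝ :=
  fun x => ∑ i, s i * (x : Fin d → ℝ) i

/-- The law of a vector in `ℝ^d` with i.i.d. `Exp(η)` entries, where `Exp(η)` has the distribution
function `1 - exp (-s / η)`, that is, mean `η` and rate `η⁻¹`. -/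
def pertLaw (d : ℕ) (η : ℝ) : Measure (Fin d → ℝ) :=
  Measure.pi fun _ => expMeasure η⁻¹

/-- `x` minimizes the perturbed objective `f - ⟨s, ·⟩` over `X`. -/
def IsPertMin {d : ℕ} {X : Set (Fin d → ℝ)} (f : X → ℝ) (s : Fin d → ℝ) (x : X) : Prop :=
  ∀ y : X, f x - linPert X s x ≤ f y - linPert X s y

/-- `xf` is the random variable `x_f(σ)`: a version of `argmin_{x ∈ X} f x - ⟨s, x⟩`, as a function
of the perturbation vector `s`. -/
def IsPertArgmin {d : ℕ} {X : Set (Fin d → ℝ)} (η : ℝ) (f : X → ℝ) (xf : (Fin d → ℝ) → X) :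
    Prop :=
  AEMeasurable xf (pertLaw d η) ∧ ∀ᵐ s ∂(pertLaw d η), IsPertMin f s (xf s)

/-- The predictions are `β`-stable: `γ_𝓕(∇Φ(f), ∇Φ(g)) ≤ β ‖f - g‖_𝓕` for all `f, g ∈ 𝓕`, where
`∇Φ(f)` is the distribution of `x_f(σ)`. -/
def IsStable {d : ℕ} (X : Set (Fin d → ℝ)) (η β : ℝ) : Prop :=
  ∀ f ∈ lipClass X, ∀ g ∈ lipClass X, ∀ xf xg : (Fin d → ℝ) → X,
    IsPertArgmin η f xf → IsPertArgmin η g xg →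
      ipm ((pertLaw d η).map xf) ((pertLaw d η).map xg) ≤ β * lipSemi (f - g)

/-- The empirical distribution of the points `x_1, …, x_m`, as a random measure. -/
def empirical {E Ω : Type*} [MeasurableSpace E] {m : ℕ} (x : Fin m → Ω → E) (ω : Ω) : Measure E :=
  (m : ENNReal)⁻¹ • ∑ j, Measure.dirac (x j ω)

/-- `Q` is (a version of) the conditional expectation `E[P | 𝒢]` of the random probability
measure `P`. -/
structure IsCondExpMeasure {E Ω : Type*} [MeasurableSpace E] [MeasurableSpace Ω]
    (μ : Measure Ω) (𝒢 : MeasurableSpace Ω) (P Q : Ω → Measure E) : Prop where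
  prob : ∀ ω, IsProbabilityMeasure (Q ω)
  meas : Measurable[𝒢] Q
  condExp : ∀ B : Set E, MeasurableSet B →
    (fun ω => (Q ω).real B) =ᵐ[μ] μ[fun ω => (P ω).real B | 𝒢]

/-- The sum `f_1 + ⋯ + f_{t-1}` of the losses seen before round `t`. -/
def pastLoss {Ω E : Type*} (f : ℕ → Ω → E → ℝ) (t : ℕ) (ω : Ω) : E → ℝ :=
  fun x => ∑ s ∈ Finset.Ico 1 t, f s ω x

/-- The `σ`-algebra generated by `f_1, …, f_{t-1}` and `P_1, …, P_{t-1}`. -/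
abbrev pastSigma {Ω E : Type*} [MeasurableSpace E] (f : ℕ → Ω → E → ℝ) (P : ℕ → Ω → Measure E)
    (t : ℕ) : MeasurableSpace Ω :=
  ⨆ s ∈ Finset.Ico 1 t,
    MeasurableSpace.comap (f s) inferInstance ⊔ MeasurableSpace.comap (P s) inferInstance

/-- A run of `T` rounds of nonconvex OFTPL with `m` samples per round against a possibly adaptive
adversary. In round `t ∈ {1, …, T}` the guess is `g t`, the loss is `f t`, the perturbations are
`σ t j`, the perturbed best responses are `x t j`, and the learner plays `x t (J t)`, where `J t` is
uniform on the `m` indices. The `σ`-algebra `ℋ t` represents everything that is determined before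
the learner draws the randomness of round `t`; since the adversary moves simultaneously with the
learner, it includes `f t`. -/
structure IsRun {d : ℕ} (X : Set (Fin d → ℝ)) (η : ℝ) (m T : ℕ) {Ω : Type*}
    [mΩ : MeasurableSpace Ω] (μ : Measure Ω) (ℋ : Filtration ℕ mΩ) (f g : ℕ → Ω → X → ℝ)
    (σ : ℕ → Fin m → Ω → Fin d → ℝ) (x : ℕ → Fin m → Ω → X) (J : ℕ → Ω → Fin m) : Prop where
  loss_mem : ∀ t ∈ Finset.Icc 1 T, ∀ ω, f t ω ∈ lipClass X
  guess_mem : ∀ t ∈ Finset.Icc 1 T, ∀ ω, g t ω ∈ lipClass X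
  loss_meas : ∀ t ∈ Finset.Icc 1 T, Measurable[ℋ t] (f t)
  guess_meas : ∀ t ∈ Finset.Icc 1 T, Measurable[ℋ t] (g t)
  pert_meas : ∀ t ∈ Finset.Icc 1 T, ∀ j, Measurable[ℋ (t + 1)] (σ t j)
  pred_meas : ∀ t ∈ Finset.Icc 1 T, ∀ j, Measurable[ℋ (t + 1)] (x t j)
  index_meas : ∀ t ∈ Finset.Icc 1 T, Measurable[ℋ (t + 1)] (J t)
  pert_law : ∀ t ∈ Finset.Icc 1 T, ∀ j, μ.map (σ t j) = pertLaw d η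
  pert_iIndep : ∀ t ∈ Finset.Icc 1 T, iIndepFun (σ t) μ
  pert_indep : ∀ t ∈ Finset.Icc 1 T,
    Indep (⨆ j, MeasurableSpace.comap (σ t j) inferInstance) (ℋ t) μ
  pred_min : ∀ t ∈ Finset.Icc 1 T, ∀ j, ∀ᵐ ω ∂μ,
    IsPertMin (pastLoss f t ω + g t ω) (σ t j ω) (x t j ω)
  index_unif : ∀ t ∈ Finset.Icc 1 T, ∀ k, μ {ω | J t ω = k} = (m : ENNReal)⁻¹
  index_indep : ∀ t ∈ Finset.Icc 1 T,
    Indep (MeasurableSpace.comap (J t) inferInstance)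
      (ℋ t ⊔ ⨆ j, (MeasurableSpace.comap (σ t j) inferInstance ⊔
        MeasurableSpace.comap (x t j) inferInstance)) μ

end

end OFTPL

/-! The potential Φ(f) = E[max over X of (⟨σ,·⟩ - f) - max over X of ⟨σ,·⟩] (`pot`) is convex in f,
and minus the law of the perturbed minimizer (`gradLaw`) is a subgradient at f. Everything rests on
three properties of it.

Uniqueness. For fixed f the maximum is a Lipschitz function of the perturbation, hence
differentiable almost everywhere, and at such a point every minimizer must equal the gradient
(`IsPertMin.coord_eq_fderiv`).

Stability. Raise one coordinate of the perturbation by c. Optimality forces the i-th coordinates of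
both new minimizers above those of both old ones, up to (L/c) times the ℓ¹ distance of the old ones,
where L bounds ‖f - g‖ (`max_coord_sub_le_min_coord_shift`). The exponential density changes by a
factor at most exp(c/η) under the shift, so the expected smaller coordinate rises by at most cD/η
(`integral_shift_sub_le`). Summing over coordinates with c = 2dL bounds the expected ℓ¹ distance by
4d²DL/η. This couples the two laws through the same perturbation.

Regret. A β-Lipschitz gradient improves the convexity inequality of Φ by γ²/(4β)
(`pot_sub_integral_add_sq_le`). Comparing Φ at the past losses, at past plus guess and at past plus
loss bounds one round (`integral_gradLaw_le`), and the rounds telescope. The final potential costs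
at most D E‖σ‖, and E‖σ‖ ≤ ηH_d because the expected maximum of d exponentials is ηH_d. The round's
perturbations are independent of loss, guess and past, so conditionally every sample has law
`gradLaw`; this passes the pathwise bound to expectations and identifies the two conditional
expectations in the negative term. -/

namespace OFTPL

/-! ### The ℓ¹ Lipschitz class and linear perturbations -/

section Lipschitz

variable {d : ℕ} {X : Set (Fin d → ℝ)}

lemma l1Dist_nonneg (x y : Fin d → ℝ) : 0 ≤ l1Dist x y :=
  Finset.sum_nonneg fun _ _ => abs_nonneg _

lemma l1Dist_comm (x y : Fin d → ℝ) : l1Dist x y = l1Dist y x :=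
  Finset.sum_congr rfl fun _ _ => abs_sub_comm _ _

lemma l1Dist_self (x : Fin d → ℝ) : l1Dist x x = 0 := by simp [l1Dist]

lemma l1Dist_triangle (x y z : Fin d → ℝ) : l1Dist x z ≤ l1Dist x y + l1Dist y z := by
  rw [l1Dist, l1Dist, l1Dist, ← Finset.sum_add_distrib]
  exact Finset.sum_le_sum fun _ _ => abs_sub_le _ _ _

lemma abs_coord_sub_le_l1Dist (x y : Fin d → ℝ) (i : Fin d) : |x i - y i| ≤ l1Dist x y :=
  Finset.single_le_sum (f := fun i => |x i - y i|) (fun _ _ => abs_nonneg _) (Finset.mem_univ i)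

lemma l1Dist_pos {x y : Fin d → ℝ} (h : x ≠ y) : 0 < l1Dist x y := by
  obtain ⟨i, hi⟩ := Function.ne_iff.1 h
  exact (abs_pos.2 (sub_ne_zero.2 hi)).trans_le (abs_coord_sub_le_l1Dist x y i)

lemma continuous_l1Dist : Continuous fun p : (Fin d → ℝ) × (Fin d → ℝ) => l1Dist p.1 p.2 := by
  unfold l1Dist
  fun_prop

lemma l1Dist_le_card_mul_dist (x y : Fin d → ℝ) : l1Dist x y ≤ d * dist x y := by
  calc l1Dist x y ≤ ∑ _i : Fin d, dist x y :=
        Finset.sum_le_sum fun i _ => by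
          rw [← Real.dist_eq]; exact dist_le_pi_dist x y i
    _ = d * dist x y := by simp

lemma lipSemi_nonneg (f : X → ℝ) : 0 ≤ lipSemi f := by
  refine Real.sSup_nonneg ?_
  rintro r ⟨x, y, -, rfl⟩
  exact div_nonneg (abs_nonneg _) (l1Dist_nonneg _ _)

lemma lipSemi_le {f : X → ℝ} {K : ℝ} (hK : 0 ≤ K)
    (h : ∀ x y : X, |f x - f y| ≤ K * l1Dist (x : Fin d → ℝ) y) : lipSemi f ≤ K := by
  refine Real.sSup_le ?_ hK
  rintro r ⟨x, y, hxy, rfl⟩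
  exact (div_le_iff₀ (l1Dist_pos (Subtype.coe_ne_coe.2 hxy))).2 (h x y)

lemma abs_sub_le_lipSemi {f : X → ℝ} (hf : f ∈ lipClass X) (x y : X) :
    |f x - f y| ≤ lipSemi f * l1Dist (x : Fin d → ℝ) y := by
  rcases eq_or_ne x y with rfl | hxy
  · simp [l1Dist_self]
  obtain ⟨K, hK⟩ := hf
  rw [← div_le_iff₀ (l1Dist_pos (Subtype.coe_ne_coe.2 hxy))]
  refine le_csSup ⟨K, ?_⟩ ⟨x, y, hxy, rfl⟩
  rintro r ⟨x, y, hxy, rfl⟩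
  exact (div_le_iff₀ (l1Dist_pos (Subtype.coe_ne_coe.2 hxy))).2 (hK x y)

lemma zero_mem_lipClass : (0 : X → ℝ) ∈ lipClass X := ⟨0, by simp⟩

lemma add_mem_lipClass {f g : X → ℝ} (hf : f ∈ lipClass X) (hg : g ∈ lipClass X) :
    f + g ∈ lipClass X := by
  obtain ⟨K, hK⟩ := hf
  obtain ⟨M, hM⟩ := hg
  refine ⟨K + M, fun x y => ?_⟩
  have : (f + g) x - (f + g) y = (f x - f y) + (g x - g y) := by simp; ring
  rw [this, add_mul]
  exact (abs_add_le _ _).trans (add_le_add (hK x y) (hM x y))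

lemma smul_mem_lipClass (c : ℝ) {f : X → ℝ} (hf : f ∈ lipClass X) : c • f ∈ lipClass X := by
  obtain ⟨K, hK⟩ := hf
  refine ⟨|c| * K, fun x y => ?_⟩
  rw [Pi.smul_apply, Pi.smul_apply, smul_eq_mul, smul_eq_mul, ← mul_sub, abs_mul, mul_assoc]
  exact mul_le_mul_of_nonneg_left (hK x y) (abs_nonneg c)

lemma neg_mem_lipClass {f : X → ℝ} (hf : f ∈ lipClass X) : -f ∈ lipClass X := by
  simpa using smul_mem_lipClass (-1) hf

lemma sub_mem_lipClass {f g : X → ℝ} (hf : f ∈ lipClass X) (hg : g ∈ lipClass X) :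
    f - g ∈ lipClass X := by
  rw [sub_eq_add_neg]
  exact add_mem_lipClass hf (neg_mem_lipClass hg)

lemma lipSemi_add_le {f g : X → ℝ} (hf : f ∈ lipClass X) (hg : g ∈ lipClass X) :
    lipSemi (f + g) ≤ lipSemi f + lipSemi g := by
  refine lipSemi_le (add_nonneg (lipSemi_nonneg f) (lipSemi_nonneg g)) fun x y => ?_
  have : (f + g) x - (f + g) y = (f x - f y) + (g x - g y) := by simp; ring
  rw [this, add_mul]
  exact (abs_add_le _ _).trans
    (add_le_add (abs_sub_le_lipSemi hf x y) (abs_sub_le_lipSemi hg x y))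

lemma lipSemi_smul_le (c : ℝ) {f : X → ℝ} (hf : f ∈ lipClass X) :
    lipSemi (c • f) ≤ |c| * lipSemi f := by
  refine lipSemi_le (mul_nonneg (abs_nonneg c) (lipSemi_nonneg f)) fun x y => ?_
  rw [Pi.smul_apply, Pi.smul_apply, smul_eq_mul, smul_eq_mul, ← mul_sub, abs_mul, mul_assoc]
  exact mul_le_mul_of_nonneg_left (abs_sub_le_lipSemi hf x y) (abs_nonneg c)

lemma continuous_of_mem_lipClass {f : X → ℝ} (hf : f ∈ lipClass X) : Continuous f := by
  have hK := abs_sub_le_lipSemi hf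
  refine (LipschitzWith.of_dist_le_mul (K := ⟨lipSemi f * d, by
    exact mul_nonneg (lipSemi_nonneg f) (Nat.cast_nonneg d)⟩) fun x y => ?_).continuous
  change |f x - f y| ≤ lipSemi f * d * dist (x : Fin d → ℝ) y
  rw [mul_assoc]
  exact (hK x y).trans (mul_le_mul_of_nonneg_left
    (l1Dist_le_card_mul_dist _ _) (lipSemi_nonneg f))

lemma integrable_of_mem_lipClass [CompactSpace X] {f : X → ℝ} (hf : f ∈ lipClass X)
    (P : Measure X) [IsFiniteMeasure P] : Integrable f P :=
  (continuous_of_mem_lipClass hf).integrable_of_hasCompactSupport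
    (HasCompactSupport.of_compactSpace f)

lemma linPert_sub (s : Fin d → ℝ) (x y : X) :
    linPert X s x - linPert X s y = ∑ i, s i * ((x : Fin d → ℝ) i - (y : Fin d → ℝ) i) := by
  simp [linPert, ← Finset.sum_sub_distrib, mul_sub]

lemma abs_linPert_sub_le (s : Fin d → ℝ) (x y : X) :
    |linPert X s x - linPert X s y| ≤ ‖s‖ * l1Dist (x : Fin d → ℝ) y := by
  rw [linPert_sub, l1Dist, Finset.mul_sum]
  refine (Finset.abs_sum_le_sum_abs _ _).trans (Finset.sum_le_sum fun i _ => ?_)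
  rw [abs_mul]
  exact mul_le_mul_of_nonneg_right (norm_le_pi_norm s i) (abs_nonneg _)

lemma linPert_mem_lipClass (s : Fin d → ℝ) : linPert X s ∈ lipClass X :=
  ⟨‖s‖, abs_linPert_sub_le s⟩

lemma lipSemi_linPert_le (s : Fin d → ℝ) : lipSemi (linPert X s) ≤ ‖s‖ :=
  lipSemi_le (norm_nonneg s) (abs_linPert_sub_le s)

lemma linPert_add (s t : Fin d → ℝ) : linPert X (s + t) = linPert X s + linPert X t := by
  ext x; simp [linPert, add_mul, Finset.sum_add_distrib]

lemma continuous_lipSemi_linPert :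
    Continuous fun s : Fin d → ℝ => lipSemi (linPert X s) := by
  refine (LipschitzWith.of_le_add (f := fun s : Fin d → ℝ => lipSemi (linPert X s))
    fun s t => ?_).continuous
  have h := lipSemi_add_le (linPert_mem_lipClass (X := X) t) (linPert_mem_lipClass (s - t))
  rw [← linPert_add, add_sub_cancel] at h
  rw [dist_eq_norm]
  exact h.trans (add_le_add_right (lipSemi_linPert_le _) _)

/-- A pair differing only in coordinate i has difference quotient exactly |s i|, so the seminorm
dominates every coordinate of s. -/
lemma lipSemi_linPert_eq
    (hX : ∀ i : Fin d, ∃ x ∈ X, ∃ y ∈ X, x ≠ y ∧ ∀ k, k ≠ i → x k = y k)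
    (s : Fin d → ℝ) : lipSemi (linPert X s) = ‖s‖ := by
  refine le_antisymm (lipSemi_linPert_le s) ?_
  refine (pi_norm_le_iff_of_nonneg (lipSemi_nonneg _)).2 fun i => ?_
  obtain ⟨x, hx, y, hy, hxy, hk⟩ := hX i
  have h := abs_sub_le_lipSemi (linPert_mem_lipClass (X := X) s) ⟨x, hx⟩ ⟨y, hy⟩
  have hi : ∀ j ∈ Finset.univ, j ≠ i → |x j - y j| = 0 := fun j _ hj => by simp [hk j hj]
  rw [linPert_sub, Finset.sum_eq_single i (fun j _ hj => by simp [hk j hj]) (by simp)] at h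
  rw [l1Dist, Finset.sum_eq_single i hi (by simp), abs_mul] at h
  refine le_of_mul_le_mul_right h (abs_pos.2 (sub_ne_zero.2 fun he => hxy ?_))
  ext j
  by_cases hj : j = i
  · rw [hj]; exact he
  · exact hk j hj

end Lipschitz

/-! ### The integral probability metric and its diameter -/

section IPM

variable {d : ℕ} {X : Set (Fin d → ℝ)}

lemma exists_l1Dist_le [CompactSpace X] :
    ∃ M : ℝ, 0 ≤ M ∧ ∀ x y : X, l1Dist (x : Fin d → ℝ) y ≤ M := by
  have hc : Continuous fun p : X × X => l1Dist (p.1 : Fin d → ℝ) p.2 :=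
    continuous_l1Dist.comp
      ((continuous_subtype_val.comp continuous_fst).prodMk
        (continuous_subtype_val.comp continuous_snd))
  obtain ⟨M, hM⟩ := (isCompact_range hc).bddAbove
  exact ⟨max M 0, le_max_right _ _, fun x y => (hM ⟨(x, y), rfl⟩).trans (le_max_left _ _)⟩

lemma abs_integral_sub_le [CompactSpace X] {f : X → ℝ} (hf : f ∈ lipClass X) {M : ℝ}
    (hM : ∀ x y : X, l1Dist (x : Fin d → ℝ) y ≤ M) (P Q : Measure X)
    [IsProbabilityMeasure P] [IsProbabilityMeasure Q] :
    |∫ x, f x ∂P - ∫ x, f x ∂Q| ≤ lipSemi f * M := by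
  have key : ∀ x y : X, f x - f y ≤ lipSemi f * M := fun x y =>
    (le_abs_self _).trans ((abs_sub_le_lipSemi hf x y).trans
      (mul_le_mul_of_nonneg_left (hM x y) (lipSemi_nonneg f)))
  have main : ∀ (P Q : Measure X) [IsProbabilityMeasure P] [IsProbabilityMeasure Q],
      ∫ x, f x ∂P - ∫ x, f x ∂Q ≤ lipSemi f * M := by
    intro P Q _ _
    have h1 : ∀ y : X, ∫ x, f x ∂P ≤ lipSemi f * M + f y := fun y => by
      have := integral_mono (integrable_of_mem_lipClass hf P)
        (integrable_const (lipSemi f * M + f y)) fun x => by linarith [key x y]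
      simpa using this
    have h2 := integral_mono (integrable_const (∫ x, f x ∂P - lipSemi f * M))
      (integrable_of_mem_lipClass hf Q) fun y => by linarith [h1 y]
    simp only [integral_const, probReal_univ, one_smul] at h2
    linarith
  exact abs_le.2 ⟨by linarith [main Q P], main P Q⟩

lemma ipm_nonneg (P Q : Measure X) : 0 ≤ ipm P Q := by
  refine Real.sSup_nonneg ?_
  rintro r ⟨f, -, -, rfl⟩
  exact abs_nonneg _

lemma ipm_comm (P Q : Measure X) : ipm P Q = ipm Q P := by
  simp only [ipm, abs_sub_comm]

lemma bddAbove_ipm_set [CompactSpace X] (P Q : Measure X) [IsProbabilityMeasure P]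
    [IsProbabilityMeasure Q] :
    BddAbove {r | ∃ f ∈ lipClass X, lipSemi f ≤ 1 ∧ r = |∫ x, f x ∂P - ∫ x, f x ∂Q|} := by
  obtain ⟨M, hM0, hM⟩ := exists_l1Dist_le (X := X)
  refine ⟨M, ?_⟩
  rintro r ⟨f, hf, hf1, rfl⟩
  exact (abs_integral_sub_le hf hM P Q).trans (mul_le_of_le_one_left hM0 hf1)

lemma le_ipm [CompactSpace X] {f : X → ℝ} (hf : f ∈ lipClass X) (hf1 : lipSemi f ≤ 1)
    (P Q : Measure X) [IsProbabilityMeasure P] [IsProbabilityMeasure Q] :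
    |∫ x, f x ∂P - ∫ x, f x ∂Q| ≤ ipm P Q :=
  le_csSup (bddAbove_ipm_set P Q) ⟨f, hf, hf1, rfl⟩

lemma ipm_le {P Q : Measure X} {K : ℝ} (hK : 0 ≤ K)
    (h : ∀ f ∈ lipClass X, lipSemi f ≤ 1 → |∫ x, f x ∂P - ∫ x, f x ∂Q| ≤ K) : ipm P Q ≤ K := by
  refine Real.sSup_le ?_ hK
  rintro r ⟨f, hf, hf1, rfl⟩
  exact h f hf hf1

lemma ipm_le_diam [CompactSpace X] (P Q : Measure X) [IsProbabilityMeasure P]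
    [IsProbabilityMeasure Q] : ipm P Q ≤ diam X := by
  obtain ⟨M, hM0, hM⟩ := exists_l1Dist_le (X := X)
  refine le_csSup ⟨M, ?_⟩ ⟨P, Q, inferInstance, inferInstance, rfl⟩
  rintro r ⟨P, Q, hP, hQ, rfl⟩
  exact ipm_le hM0 fun f hf hf1 =>
    (abs_integral_sub_le hf hM P Q).trans (mul_le_of_le_one_left hM0 hf1)

lemma diam_nonneg : 0 ≤ diam X := by
  refine Real.sSup_nonneg ?_
  rintro r ⟨P, Q, -, -, rfl⟩
  exact ipm_nonneg P Q

/-- The distance to y is itself a 1-Lipschitz test function; it is tested on the Dirac masses at x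
and y. -/
lemma l1Dist_le_diam [CompactSpace X] (x y : X) : l1Dist (x : Fin d → ℝ) y ≤ diam X := by
  have hL : ∀ a b : X, |l1Dist (a : Fin d → ℝ) y - l1Dist (b : Fin d → ℝ) y|
      ≤ 1 * l1Dist (a : Fin d → ℝ) b := fun a b => by
    rw [one_mul, abs_le]
    constructor
    · linarith [l1Dist_triangle (b : Fin d → ℝ) a y, l1Dist_comm (a : Fin d → ℝ) b]
    · linarith [l1Dist_triangle (a : Fin d → ℝ) b y]
  have h := le_ipm (f := fun a : X => l1Dist (a : Fin d → ℝ) y) ⟨1, hL⟩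
    (lipSemi_le zero_le_one hL) (Measure.dirac x) (Measure.dirac y)
  rw [integral_dirac, integral_dirac, l1Dist_self, sub_zero, abs_of_nonneg (l1Dist_nonneg _ _)] at h
  exact h.trans (ipm_le_diam _ _)

lemma abs_integral_sub_le_lipSemi_mul_ipm [CompactSpace X] {f : X → ℝ} (hf : f ∈ lipClass X)
    (P Q : Measure X) [IsProbabilityMeasure P] [IsProbabilityMeasure Q] :
    |∫ x, f x ∂P - ∫ x, f x ∂Q| ≤ lipSemi f * ipm P Q := by
  -- A vanishing seminorm cannot be normalized to 1, but then the crude bound by the ℓ¹ diameter is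
  -- already 0.
  rcases (lipSemi_nonneg f).eq_or_lt with h0 | hpos
  · obtain ⟨M, -, hM⟩ := exists_l1Dist_le (X := X)
    have := abs_integral_sub_le hf hM P Q
    rw [← h0, zero_mul] at this ⊢
    exact this
  · have h1 : lipSemi ((lipSemi f)⁻¹ • f) ≤ 1 := by
      refine (lipSemi_smul_le _ hf).trans_eq ?_
      rw [abs_of_pos (inv_pos.2 hpos), inv_mul_cancel₀ hpos.ne']
    have h := le_ipm (smul_mem_lipClass _ hf) h1 P Q
    simp only [Pi.smul_apply, smul_eq_mul, integral_const_mul] at h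
    rw [← mul_sub, abs_mul, abs_of_pos (inv_pos.2 hpos)] at h
    calc |∫ x, f x ∂P - ∫ x, f x ∂Q|
        = lipSemi f * ((lipSemi f)⁻¹ * |∫ x, f x ∂P - ∫ x, f x ∂Q|) := by
          rw [mul_inv_cancel_left₀ hpos.ne']
      _ ≤ _ := mul_le_mul_of_nonneg_left h hpos.le

end IPM

/-! ### The exponential perturbation: shifts and expected maximum -/

section PertLaw

open Set Filter Topology

lemma isProbabilityMeasure_pertLaw (d : ℕ) {η : ℝ} (hη : 0 < η) :
    IsProbabilityMeasure (pertLaw d η) := by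
  have := isProbabilityMeasure_expMeasure (inv_pos.2 hη)
  unfold pertLaw
  infer_instance

lemma pi_withDensity_eq {d : ℕ} {ρ : ℝ → ℝ} (h0 : ∀ x, 0 ≤ ρ x) (hi : Integrable ρ)
    [SigmaFinite ((volume : Measure ℝ).withDensity fun x => ENNReal.ofReal (ρ x))] :
    Measure.pi (fun _ : Fin d => (volume : Measure ℝ).withDensity fun x => ENNReal.ofReal (ρ x)) =
      (volume : Measure (Fin d → ℝ)).withDensity fun s => ENNReal.ofReal (∏ i, ρ (s i)) := by
  refine Measure.pi_eq fun B hB => ?_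
  rw [withDensity_apply _ (MeasurableSet.univ_pi hB), volume_pi, Measure.restrict_pi_pi]
  have hiB : ∀ i, Integrable ρ (volume.restrict (B i)) := fun i => hi.restrict
  rw [← ofReal_integral_eq_lintegral_ofReal (Integrable.fintype_prod (f := fun _ => ρ) hiB)
    (Eventually.of_forall fun s => Finset.prod_nonneg fun i _ => h0 _),
    integral_fintype_prod_eq_prod (f := fun _ => ρ),
    ENNReal.ofReal_prod_of_nonneg fun i _ => integral_nonneg h0]
  refine Finset.prod_congr rfl fun i _ => ?_
  rw [withDensity_apply _ (hB i),
    ofReal_integral_eq_lintegral_ofReal (hiB i) (Eventually.of_forall h0)]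

lemma integrable_exponentialPDFReal {r : ℝ} (hr : 0 < r) : Integrable (exponentialPDFReal r) := by
  refine ⟨(measurable_exponentialPDFReal r).aestronglyMeasurable, ?_⟩
  rw [hasFiniteIntegral_iff_ofReal (Eventually.of_forall (exponentialPDFReal_nonneg hr))]
  exact (lintegral_exponentialPDF_eq_one hr).trans_lt ENNReal.one_lt_top

lemma pertLaw_eq_withDensity (d : ℕ) {η : ℝ} (hη : 0 < η) :
    pertLaw d η = (volume : Measure (Fin d → ℝ)).withDensity
      fun s => ENNReal.ofReal (∏ i, exponentialPDFReal η⁻¹ (s i)) := by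
  have := isProbabilityMeasure_expMeasure (inv_pos.2 hη)
  have h : expMeasure η⁻¹ =
    (volume : Measure ℝ).withDensity fun x => ENNReal.ofReal (exponentialPDFReal η⁻¹ x) := rfl
  unfold pertLaw
  rw [h] at this ⊢
  exact pi_withDensity_eq (exponentialPDFReal_nonneg (inv_pos.2 hη))
    (integrable_exponentialPDFReal (inv_pos.2 hη))

lemma pertLaw_absolutelyContinuous (d : ℕ) {η : ℝ} (hη : 0 < η) :
    pertLaw d η ≪ (volume : Measure (Fin d → ℝ)) := by
  rw [pertLaw_eq_withDensity d hη]
  exact withDensity_absolutelyContinuous _ _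

/-- Where the shifted density is positive, the two sides agree (memorylessness); elsewhere the left
side is 0. -/
lemma exponentialPDFReal_sub_le {r c : ℝ} (hr : 0 < r) (hc : 0 ≤ c) (x : ℝ) :
    exponentialPDFReal r (x - c) ≤ Real.exp (r * c) * exponentialPDFReal r x := by
  have e : ∀ y, exponentialPDFReal r y = if 0 ≤ y then r * Real.exp (-(r * y)) else 0 := by
    intro y
    rw [exponentialPDFReal, gammaPDFReal]
    simp
  rcases lt_or_ge (x - c) 0 with h | h
  · rw [e, if_neg h.not_ge]
    exact mul_nonneg (Real.exp_pos _).le (exponentialPDFReal_nonneg hr x)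
  · rw [e, e, if_pos h, if_pos (by linarith), mul_left_comm, ← Real.exp_add]
    exact le_of_eq (by ring_nf)

lemma lintegral_shift_le {d : ℕ} {η : ℝ} (hη : 0 < η) {c : ℝ} (hc : 0 ≤ c) (i : Fin d)
    {h : (Fin d → ℝ) → ENNReal} (hh : Measurable h) :
    ∫⁻ s, h (s + Pi.single i c) ∂(pertLaw d η) ≤
      ENNReal.ofReal (Real.exp (c / η)) * ∫⁻ s, h s ∂(pertLaw d η) := by
  have hρ : Measurable fun s : Fin d → ℝ =>
      ENNReal.ofReal (∏ i, exponentialPDFReal η⁻¹ (s i)) := by fun_prop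
  have hr := inv_pos.2 hη
  rw [pertLaw_eq_withDensity d hη, lintegral_withDensity_eq_lintegral_mul _ hρ hh,
    lintegral_withDensity_eq_lintegral_mul _ hρ (by fun_prop),
    ← lintegral_add_right_eq_self _ (-Pi.single i c), ← lintegral_const_mul _ (by fun_prop)]
  refine lintegral_mono fun s => ?_
  simp only [Pi.mul_apply, neg_add_cancel_right]
  rw [← mul_assoc]
  gcongr
  rw [← ENNReal.ofReal_mul (Real.exp_pos _).le]
  refine ENNReal.ofReal_le_ofReal ?_
  have hcongr : ∏ j ∈ Finset.univ.erase i, exponentialPDFReal η⁻¹ ((s + -(Pi.single i c : Fin d → ℝ)) j) =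
      ∏ j ∈ Finset.univ.erase i, exponentialPDFReal η⁻¹ (s j) :=
    Finset.prod_congr rfl fun j hj => by simp [(Finset.mem_erase.1 hj).1]
  rw [← Finset.mul_prod_erase _ _ (Finset.mem_univ i), hcongr,
    ← Finset.mul_prod_erase _ (fun j => exponentialPDFReal η⁻¹ (s j)) (Finset.mem_univ i),
    ← mul_assoc]
  refine mul_le_mul_of_nonneg_right ?_
    (Finset.prod_nonneg fun j _ => exponentialPDFReal_nonneg hr _)
  have := exponentialPDFReal_sub_le hr hc (s i)
  rw [inv_mul_eq_div] at this
  simpa [sub_eq_add_neg] using this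

/-- Lets almost sure optimality at s be used at the shifted perturbation as well. -/
lemma quasiMeasurePreserving_shift {d : ℕ} {η : ℝ} (hη : 0 < η) {c : ℝ} (hc : 0 ≤ c)
    (i : Fin d) :
    Measure.QuasiMeasurePreserving (fun s : Fin d → ℝ => s + Pi.single i c)
      (pertLaw d η) (pertLaw d η) := by
  refine ⟨by fun_prop, Measure.AbsolutelyContinuous.mk fun B hB h0 => ?_⟩
  have h := lintegral_shift_le hη hc i (measurable_one.indicator hB)
  rw [lintegral_indicator_one hB, h0, mul_zero, nonpos_iff_eq_zero] at h
  rw [Measure.map_apply (by fun_prop) hB, ← lintegral_indicator_one (by measurability), ← h]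
  rfl

/-- Shifting one coordinate of the perturbation by `c` changes the expectation of a function with
values in `[a, a + D]` by at most `c * D / η` in the upward direction. -/
lemma integral_shift_sub_le {d : ℕ} {η : ℝ} (hη : 0 < η) {c : ℝ} (hc : 0 ≤ c) (i : Fin d)
    {h : (Fin d → ℝ) → ℝ} (hh : Measurable h) {a D : ℝ} (ha : ∀ s, a ≤ h s)
    (hD : ∀ s, h s ≤ a + D) :
    ∫ s, h (s + Pi.single i c) ∂(pertLaw d η) - ∫ s, h s ∂(pertLaw d η) ≤ c / η * D := by
  have := isProbabilityMeasure_pertLaw d hη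
  have hD0 : 0 ≤ D := by linarith [ha 0, hD 0]
  have hbd : ∀ s, ‖h s - a‖ ≤ D := fun s => by
    rw [Real.norm_of_nonneg (by linarith [ha s])]; linarith [hD s]
  have hi : Integrable (fun s => h s - a) (pertLaw d η) :=
    Integrable.of_bound (by fun_prop) D (Eventually.of_forall hbd)
  have hi' : Integrable (fun s => h (s + Pi.single i c) - a) (pertLaw d η) :=
    Integrable.of_bound (((hh.comp (measurable_add_const _)).sub_const a).aestronglyMeasurable) D
      (Eventually.of_forall fun s => hbd _)
  have h0 : ∀ s, 0 ≤ h s - a := fun s => by linarith [ha s]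
  have key := lintegral_shift_le hη hc i (h := fun s => ENNReal.ofReal (h s - a)) (by fun_prop)
  rw [← ofReal_integral_eq_lintegral_ofReal hi (Eventually.of_forall h0),
    ← ofReal_integral_eq_lintegral_ofReal hi' (Eventually.of_forall fun s => h0 _),
    ← ENNReal.ofReal_mul (Real.exp_pos _).le,
    ENNReal.ofReal_le_ofReal_iff (mul_nonneg (Real.exp_pos _).le (integral_nonneg h0))] at key
  have hle : ∫ s, (h (s + Pi.single i c) - a) ∂(pertLaw d η) ≤ D := by
    have := integral_mono hi' (integrable_const D) fun s => by
      have := hD (s + Pi.single i c); simp only; linarith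
    simpa using this
  have hnn : 0 ≤ ∫ s, (h (s + Pi.single i c) - a) ∂(pertLaw d η) :=
    integral_nonneg fun s => h0 _
  have e1 : ∫ s, (h (s + Pi.single i c) - a) ∂(pertLaw d η) =
      ∫ s, h (s + Pi.single i c) ∂(pertLaw d η) - a := by
    have : Integrable (fun s => h (s + Pi.single i c)) (pertLaw d η) := 
      (hi'.add (integrable_const a)).congr (Eventually.of_forall fun s => by simp)
    rw [integral_sub this (integrable_const a)]; simp
  have e2 : ∫ s, (h s - a) ∂(pertLaw d η) = ∫ s, h s ∂(pertLaw d η) - a := by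
    have : Integrable h (pertLaw d η) := 
      (hi.add (integrable_const a)).congr (Eventually.of_forall fun s => by simp)
    rw [integral_sub this (integrable_const a)]; simp
  -- With A and B the shifted and unshifted integrals of h - a, the density bound reads exp(-c/η) A
  -- ≤ B. Linearizing the exponential leaves A - B ≤ (c/η) A, and A ≤ D.
  have hexp : 1 - c / η ≤ Real.exp (-(c / η)) := by
    linarith [Real.add_one_le_exp (-(c / η))]
  set A := ∫ s, (h (s + Pi.single i c) - a) ∂(pertLaw d η)
  set B := ∫ s, (h s - a) ∂(pertLaw d η)
  have hAB : Real.exp (-(c / η)) * A ≤ B := by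
    calc _ ≤ Real.exp (-(c / η)) * (Real.exp (c / η) * B) :=
          mul_le_mul_of_nonneg_left key (Real.exp_pos _).le
      _ = B := by rw [← mul_assoc, ← Real.exp_add]; simp
  have h1 : (1 - c / η) * A ≤ B := (mul_le_mul_of_nonneg_right hexp hnn).trans hAB
  have h2 : c / η * A ≤ c / η * D := mul_le_mul_of_nonneg_left hle (by positivity)
  linarith

lemma expMeasure_closedBall {r : ℝ} (hr : 0 < r) {t : ℝ} (ht : 0 ≤ t) :
    expMeasure r (Metric.closedBall 0 t) = ENNReal.ofReal (1 - Real.exp (-(r * t))) := by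
  have := isProbabilityMeasure_expMeasure hr
  have hI : ∀ u, 0 ≤ u → expMeasure r (Iic u) = ENNReal.ofReal (1 - Real.exp (-(r * u))) := by
    intro u hu
    rw [← ofReal_cdf, cdf_expMeasure_eq hr, if_pos hu]
  have h0 : expMeasure r (Iic 0) = 0 := by rw [hI 0 le_rfl]; simp
  rw [Real.closedBall_eq_Icc, zero_sub, zero_add, ← hI t ht]
  refine le_antisymm (measure_mono fun x hx => hx.2) ?_
  calc expMeasure r (Iic t) ≤ expMeasure r (Icc (-t) t ∪ Iic 0) := by
        refine measure_mono fun x (hx : x ≤ t) => ?_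
        rcases le_total x 0 with h | h
        · exact Or.inr h
        · exact Or.inl ⟨by linarith, hx⟩
    _ ≤ expMeasure r (Icc (-t) t) + expMeasure r (Iic 0) := measure_union_le _ _
    _ = _ := by rw [h0, add_zero]

/-- A closed ball of the sup norm is a product of intervals, so its mass is the d-th power of a
one-dimensional one. -/
lemma pertLaw_norm_gt {d : ℕ} {η : ℝ} (hη : 0 < η) {t : ℝ} (ht : 0 ≤ t) :
    pertLaw d η {s | t < ‖s‖} = ENNReal.ofReal (1 - (1 - Real.exp (-(η⁻¹ * t))) ^ d) := by
  have := isProbabilityMeasure_pertLaw d hη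
  have := isProbabilityMeasure_expMeasure (inv_pos.2 hη)
  have hE : 0 ≤ 1 - Real.exp (-(η⁻¹ * t)) := by
    have : 0 ≤ η⁻¹ * t := mul_nonneg (inv_pos.2 hη).le ht
    linarith [Real.exp_le_one_iff.2 (neg_nonpos.2 this)]
  have hc : {s : Fin d → ℝ | t < ‖s‖} = (Metric.closedBall 0 t)ᶜ := by
    ext s; simp
  rw [hc, prob_compl_eq_one_sub Metric.isClosed_closedBall.measurableSet, pertLaw,
    Measure.pi_closedBall _ _ ht]
  simp only [Pi.zero_apply, expMeasure_closedBall (inv_pos.2 hη) ht, Finset.prod_const,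
    Finset.card_univ, Fintype.card_fin]
  rw [← ENNReal.ofReal_pow hE, ← ENNReal.ofReal_one, ENNReal.ofReal_sub _ (pow_nonneg hE d)]

lemma integral_Ioi_one_sub_pow {r : ℝ} (hr : 0 < r) (d : ℕ) :
    IntegrableOn (fun t => 1 - (1 - Real.exp (-(r * t))) ^ d) (Ioi 0) ∧
    ∫ t in Ioi 0, (1 - (1 - Real.exp (-(r * t))) ^ d) = r⁻¹ * ∑ k ∈ Finset.Icc 1 d, (1 : ℝ) / k := by
  -- An antiderivative: for u = 1 - exp(-rt) one has u' = r(1 - u), and 1 - u^d = (1 - u)(1 + u +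
  -- ... + u^(d-1)). It vanishes at 0, and u tends to 1 at infinity.
  set G : ℝ → ℝ := fun t =>
    ∑ k ∈ Finset.range d, r⁻¹ * ((1 - Real.exp (-(r * t))) ^ (k + 1) / (k + 1 : ℕ)) with hG
  have hder : ∀ t ∈ Ici (0 : ℝ), HasDerivAt G (1 - (1 - Real.exp (-(r * t))) ^ d) t := by
    intro t _
    have h1 : HasDerivAt (fun t => 1 - Real.exp (-(r * t))) (r * Real.exp (-(r * t))) t := by
      simpa [sub_eq_add_neg] using (hasDerivAt_neg_exp_mul_exp (r := r) (x := t)).const_add 1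
    have h2 := HasDerivAt.fun_sum fun k (_ : k ∈ Finset.range d) =>
      ((h1.pow (k + 1)).div_const ((k + 1 : ℕ) : ℝ)).const_mul r⁻¹
    convert! h2 using 1
    have hgeom := mul_neg_geom_sum (1 - Real.exp (-(r * t))) d
    rw [← hgeom, sub_sub_cancel, Finset.mul_sum]
    refine Finset.sum_congr rfl fun k _ => ?_
    have : ((k + 1 : ℕ) : ℝ) ≠ 0 := by positivity
    rw [add_tsub_cancel_right]
    field_simp
  have hpos : ∀ t ∈ Ioi (0 : ℝ), 0 ≤ 1 - (1 - Real.exp (-(r * t))) ^ d := by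
    intro t ht
    have : 0 < r * t := mul_pos hr ht
    have h1 := Real.exp_le_one_iff.2 (neg_nonpos.2 this.le)
    have h2 := Real.exp_pos (-(r * t))
    linarith [pow_le_one₀ (n := d) (by linarith : 0 ≤ 1 - Real.exp (-(r * t))) (by linarith)]
  have hlim : Tendsto G atTop (𝓝 (r⁻¹ * ∑ k ∈ Finset.Icc 1 d, (1 : ℝ) / k)) := by
    have he : Tendsto (fun t => Real.exp (-(r * t))) atTop (𝓝 0) :=
      Real.tendsto_exp_neg_atTop_nhds_zero.comp (tendsto_id.const_mul_atTop hr)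
    have h1 : Tendsto G atTop (𝓝 (∑ k ∈ Finset.range d,
        r⁻¹ * ((1 - 0 : ℝ) ^ (k + 1) / (k + 1 : ℕ)))) :=
      tendsto_finsetSum _ fun k _ =>
        (((he.const_sub 1).pow (k + 1)).div_const _).const_mul _
    convert h1 using 2
    have hI : Finset.Icc 1 d = Finset.Ico (0 + 1) (d + 1) := by ext; simp
    rw [Finset.mul_sum, Finset.range_eq_Ico, hI,
      ← Finset.sum_Ico_add' (fun k : ℕ => r⁻¹ * ((1 : ℝ) / k)) 0 d 1]
    simp
  refine ⟨integrableOn_Ioi_deriv_of_nonneg' hder hpos hlim, ?_⟩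
  rw [integral_Ioi_of_hasDerivAt_of_nonneg' hder hpos hlim]
  simp [hG]

lemma lintegral_norm_pertLaw (d : ℕ) {η : ℝ} (hη : 0 < η) :
    ∫⁻ s, ENNReal.ofReal ‖s‖ ∂(pertLaw d η) =
      ENNReal.ofReal (η * ∑ k ∈ Finset.Icc 1 d, (1 : ℝ) / k) := by
  obtain ⟨hi, he⟩ := integral_Ioi_one_sub_pow (inv_pos.2 hη) d
  rw [lintegral_eq_lintegral_meas_lt _ (Eventually.of_forall fun s => norm_nonneg s)
    measurable_norm.aemeasurable,
    setLIntegral_congr_fun measurableSet_Ioi fun t ht => pertLaw_norm_gt hη (le_of_lt ht),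
    ← ofReal_integral_eq_lintegral_ofReal hi, he, inv_inv]
  refine (ae_restrict_iff' measurableSet_Ioi).2 (Eventually.of_forall fun t ht => ?_)
  have : 0 < η⁻¹ * t := mul_pos (inv_pos.2 hη) ht
  have h1 := Real.exp_le_one_iff.2 (neg_nonpos.2 this.le)
  have h2 := Real.exp_pos (-(η⁻¹ * t))
  simp only [Pi.zero_apply]
  linarith [pow_le_one₀ (n := d) (by linarith : 0 ≤ 1 - Real.exp (-(η⁻¹ * t))) (by linarith)]

lemma integrable_norm_pertLaw (d : ℕ) {η : ℝ} (hη : 0 < η) :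
    Integrable (fun s => ‖s‖) (pertLaw d η) := by
  refine ⟨measurable_norm.aestronglyMeasurable, ?_⟩
  rw [hasFiniteIntegral_iff_ofReal (Eventually.of_forall fun s => norm_nonneg s),
    lintegral_norm_pertLaw d hη]
  exact ENNReal.ofReal_lt_top

lemma integral_norm_pertLaw (d : ℕ) {η : ℝ} (hη : 0 < η) :
    ∫ s, ‖s‖ ∂(pertLaw d η) = η * ∑ k ∈ Finset.Icc 1 d, (1 : ℝ) / k := by
  rw [integral_eq_lintegral_of_nonneg_ae (Eventually.of_forall fun s => norm_nonneg s)
    measurable_norm.aestronglyMeasurable, lintegral_norm_pertLaw d hη, ENNReal.toReal_ofReal]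
  exact mul_nonneg hη.le (Finset.sum_nonneg fun k _ => by positivity)

lemma integrable_lipSemi_linPert {d : ℕ} (X : Set (Fin d → ℝ)) {η : ℝ} (hη : 0 < η) :
    Integrable (fun s => lipSemi (linPert X s)) (pertLaw d η) :=
  (integrable_norm_pertLaw d hη).mono' continuous_lipSemi_linPert.aestronglyMeasurable
    (Eventually.of_forall fun s => by
      rw [Real.norm_of_nonneg (lipSemi_nonneg _)]; exact lipSemi_linPert_le s)

lemma integral_lipSemi_linPert_le {d : ℕ} (X : Set (Fin d → ℝ)) {η : ℝ} (hη : 0 < η) :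
    ∫ s, lipSemi (linPert X s) ∂(pertLaw d η) ≤ η * ∑ k ∈ Finset.Icc 1 d, (1 : ℝ) / k := by
  rw [← integral_norm_pertLaw d hη]
  exact integral_mono (integrable_lipSemi_linPert X hη) (integrable_norm_pertLaw d hη)
    fun s => lipSemi_linPert_le s

lemma sum_one_div_eq_harmonic (d : ℕ) :
    ∑ k ∈ Finset.Icc 1 d, (1 : ℝ) / k = (harmonic d : ℝ) := by
  rw [harmonic_eq_sum_Icc]
  simp

lemma log_le_sum_one_div {d : ℕ} (hd : 1 ≤ d) :
    Real.log d ≤ ∑ k ∈ Finset.Icc 1 d, (1 : ℝ) / k := by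
  rw [sum_one_div_eq_harmonic]
  refine le_trans ?_ (log_add_one_le_harmonic d)
  exact Real.log_le_log (by positivity) (by push_cast; linarith)

lemma sum_one_div_le_one_add_log (d : ℕ) :
    ∑ k ∈ Finset.Icc 1 d, (1 : ℝ) / k ≤ 1 + Real.log d := by
  rw [sum_one_div_eq_harmonic]
  exact harmonic_le_one_add_log d

end PertLaw

/-! ### Almost sure uniqueness and a measurable minimizer -/

section Argmin

open Set Filter Topology

variable {d : ℕ} {X : Set (Fin d → ℝ)}

/-- The maximum over `X` of the perturbation minus `f`, as a function of the perturbation. -/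
noncomputable def pertMax (f : X → ℝ) (s : Fin d → ℝ) : ℝ := ⨆ x : X, (linPert X s x - f x)

lemma continuous_linPert (s : Fin d → ℝ) : Continuous (linPert X s) :=
  continuous_of_mem_lipClass (linPert_mem_lipClass s)

lemma measurable_linPert_left (x : X) : Measurable fun s => linPert X s x := by
  unfold linPert
  fun_prop

lemma exists_isPertMin [CompactSpace X] [Nonempty X] {f : X → ℝ} (hf : f ∈ lipClass X)
    (s : Fin d → ℝ) : ∃ x, IsPertMin f s x := by
  have hc : Continuous fun x => f x - linPert X s x :=
    (continuous_of_mem_lipClass hf).sub (continuous_linPert s)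
  obtain ⟨x, -, hx⟩ := isCompact_univ.exists_isMinOn univ_nonempty hc.continuousOn
  exact ⟨x, fun y => hx (mem_univ y)⟩

lemma IsPertMin.pertMax_eq {f : X → ℝ} {s : Fin d → ℝ} {x : X} (hx : IsPertMin f s x) :
    pertMax f s = linPert X s x - f x := by
  have : Nonempty X := ⟨x⟩
  refine IsLUB.ciSup_eq (IsGreatest.isLUB ⟨⟨x, rfl⟩, ?_⟩)
  rintro _ ⟨y, rfl⟩
  linarith [hx y]

lemma le_pertMax [CompactSpace X] {f : X → ℝ} (hf : f ∈ lipClass X) (s : Fin d → ℝ) (x : X) :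
    linPert X s x - f x ≤ pertMax f s := by
  have : Nonempty X := ⟨x⟩
  obtain ⟨y, hy⟩ := exists_isPertMin hf s
  rw [hy.pertMax_eq]
  linarith [hy x]

lemma exists_lipschitzWith_pertMax [CompactSpace X] [Nonempty X] {f : X → ℝ}
    (hf : f ∈ lipClass X) : ∃ K, LipschitzWith K (pertMax f) := by
  let x₀ : X := Classical.arbitrary X
  -- Each function s ↦ ⟨s, x⟩ - f x has Lipschitz constant ‖x‖₁ in the sup norm, which is at most ‖x
  -- - x₀‖₁ + ‖x₀‖₁.
  refine ⟨(diam X + l1Dist (x₀ : Fin d → ℝ) 0).toNNReal,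
    LipschitzWith.of_le_add_mul _ fun s t => ?_⟩
  obtain ⟨x, hx⟩ := exists_isPertMin hf s
  have h1 := le_pertMax hf t x
  have h2 : linPert X s x - linPert X t x ≤ l1Dist (x : Fin d → ℝ) 0 * dist s t := by
    simp only [linPert, ← Finset.sum_sub_distrib, ← sub_mul, l1Dist, Finset.sum_mul]
    refine Finset.sum_le_sum fun i _ => (le_abs_self _).trans ?_
    rw [abs_mul, mul_comm, Pi.zero_apply, sub_zero, ← Real.dist_eq]
    exact mul_le_mul_of_nonneg_left (dist_le_pi_dist s t i) (abs_nonneg _)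
  have h3 : l1Dist (x : Fin d → ℝ) 0 ≤ diam X + l1Dist (x₀ : Fin d → ℝ) 0 :=
    (l1Dist_triangle _ (x₀ : Fin d → ℝ) _).trans (add_le_add_left (l1Dist_le_diam x x₀) _)
  rw [hx.pertMax_eq, Real.coe_toNNReal _ (add_nonneg diam_nonneg (l1Dist_nonneg _ _))]
  have h4 := mul_le_mul_of_nonneg_right h3 (dist_nonneg (x := s) (y := t))
  linarith

/-- The affine function v ↦ ⟨v, x⟩ - f x lies below `pertMax f` and touches it at s, so the
derivatives agree there. -/
lemma IsPertMin.coord_eq_fderiv [CompactSpace X] {f : X → ℝ} (hf : f ∈ lipClass X)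
    {s : Fin d → ℝ} (hs : DifferentiableAt ℝ (pertMax f) s) {x : X} (hx : IsPertMin f s x)
    (i : Fin d) : (x : Fin d → ℝ) i = fderiv ℝ (pertMax f) s (Pi.single i 1) := by
  let ℓ : (Fin d → ℝ) →L[ℝ] ℝ :=
    ∑ j, (x : Fin d → ℝ) j • ContinuousLinearMap.proj (R := ℝ) (φ := fun _ : Fin d => ℝ) j
  have hℓ : ∀ v, ℓ v = linPert X v x := fun v => by
    simp [ℓ, linPert, mul_comm]
  have hmin : IsLocalMin (fun v => pertMax f v - ℓ v) s :=
    Eventually.of_forall fun v => by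
      have h1 := le_pertMax hf v x
      have h2 := hx.pertMax_eq
      simp only [hℓ]
      linarith
  have hd := hmin.hasFDerivAt_eq_zero (hs.hasFDerivAt.sub ℓ.hasFDerivAt)
  rw [sub_eq_zero.1 hd, hℓ]
  simp [linPert, Pi.single_apply]

/-- Functions carry the σ-algebra generated by evaluations, so the supremum is reduced to a
countable dense set of points; continuity in x makes this harmless. -/
lemma measurable_pertMax [CompactSpace X] [Nonempty X] :
    Measurable fun p : lipClass X × (Fin d → ℝ) => pertMax (p.1 : X → ℝ) p.2 := by
  have hm : ∀ n : ℕ, Measurable fun p : lipClass X × (Fin d → ℝ) =>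
      linPert X p.2 (TopologicalSpace.denseSeq X n) -
        (p.1 : X → ℝ) (TopologicalSpace.denseSeq X n) := fun n =>
    ((measurable_linPert_left _).comp measurable_snd).sub
      ((measurable_pi_apply _).comp (measurable_subtype_coe.comp measurable_fst))
  refine Measurable.isLUB hm fun p => ⟨?_, fun b hb => ?_⟩
  · rintro _ ⟨n, rfl⟩
    exact le_pertMax p.1.2 _ _
  · refine ciSup_le fun x => ?_
    have hc : Continuous fun x => linPert X p.2 x - (p.1 : X → ℝ) x :=
      (continuous_linPert p.2).sub (continuous_of_mem_lipClass p.1.2)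
    exact DenseRange.induction_on (TopologicalSpace.denseRange_denseSeq X) x
      (isClosed_le hc continuous_const) fun n => hb ⟨n, rfl⟩

/-- The upper partial derivatives of `pertMax` along a sequence of difference quotients. -/
noncomputable def argCoord (p : lipClass X × (Fin d → ℝ)) (i : Fin d) : ℝ :=
  limsup (fun n : ℕ => ((1 : ℝ) / (n + 1))⁻¹ *
    (pertMax (p.1 : X → ℝ) (p.2 + Pi.single i ((1 : ℝ) / (n + 1))) - pertMax (p.1 : X → ℝ) p.2))
    atTop

/-- A jointly measurable version of the minimizer of `f - ⟨s, ·⟩` over `X`. -/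
noncomputable def pertArgmin [Nonempty X] (p : lipClass X × (Fin d → ℝ)) : X :=
  Function.extend Subtype.val id (fun _ => Classical.arbitrary X) (argCoord p)

lemma measurable_pertArgmin [CompactSpace X] [Nonempty X] :
    Measurable (pertArgmin : lipClass X × (Fin d → ℝ) → X) := by
  have hX : MeasurableSet X := (isCompact_iff_compactSpace.2 inferInstance).measurableSet
  have h1 : Measurable (argCoord : lipClass X × (Fin d → ℝ) → Fin d → ℝ) := by
    refine measurable_pi_lambda _ fun i => Measurable.limsup fun n => ?_
    have hs : Measurable fun p : lipClass X × (Fin d → ℝ) =>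
        (p.1, p.2 + Pi.single i ((1 : ℝ) / (n + 1))) :=
      measurable_fst.prodMk (measurable_snd.add_const _)
    have hq : Measurable fun p : lipClass X × (Fin d → ℝ) =>
        pertMax (p.1 : X → ℝ) (p.2 + Pi.single i ((1 : ℝ) / (n + 1))) := by
      have := (measurable_pertMax (X := X)).comp hs
      simpa only [Function.comp_def] using this
    exact (hq.sub measurable_pertMax).const_mul _
  exact ((MeasurableEmbedding.subtype_coe hX).measurable_extend measurable_id
    measurable_const).comp h1

lemma IsPertMin.eq_pertArgmin [CompactSpace X] [Nonempty X] {f : lipClass X} {s : Fin d → ℝ}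
    (hs : DifferentiableAt ℝ (pertMax (f : X → ℝ)) s) {x : X} (hx : IsPertMin (f : X → ℝ) s x) :
    x = pertArgmin (f, s) := by
  have h : argCoord (f, s) = x := by
    ext i
    have h0 : Tendsto (fun n : ℕ => (1 : ℝ) / (n + 1)) atTop (𝓝[≠] 0) :=
      tendsto_nhdsWithin_iff.2 ⟨tendsto_one_div_add_atTop_nhds_zero_nat,
        Eventually.of_forall fun n => by simp; positivity⟩
    have ht := (hs.hasFDerivAt.hasLineDerivAt (Pi.single i 1)).tendsto_slope_zero.comp h0
    rw [hx.coord_eq_fderiv f.2 hs i, ← ht.limsup_eq, argCoord]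
    refine congrArg (fun u => limsup u atTop) (funext fun n => ?_)
    simp only [Function.comp_apply, smul_eq_mul]
    rw [← Pi.single_smul, smul_eq_mul, mul_one]
  rw [pertArgmin, h]
  exact (Subtype.val_injective.extend_apply id _ x).symm

/-- Rademacher's theorem applies because the perturbation law has a density. -/
lemma ae_isPertMin_iff [CompactSpace X] [Nonempty X] {η : ℝ} (hη : 0 < η) (f : lipClass X) :
    ∀ᵐ s ∂(pertLaw d η), ∀ x : X, IsPertMin (f : X → ℝ) s x ↔ x = pertArgmin (f, s) := by
  obtain ⟨K, hK⟩ := exists_lipschitzWith_pertMax f.2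
  filter_upwards [(pertLaw_absolutelyContinuous d hη).ae_le
    (hK.ae_differentiableAt (μ := volume))] with s hs x
  refine ⟨fun hx => hx.eq_pertArgmin hs, ?_⟩
  rintro rfl
  obtain ⟨y, hy⟩ := exists_isPertMin f.2 s
  rwa [hy.eq_pertArgmin hs] at hy

lemma ae_isPertMin_pertArgmin [CompactSpace X] [Nonempty X] {η : ℝ} (hη : 0 < η)
    (f : lipClass X) : ∀ᵐ s ∂(pertLaw d η), IsPertMin (f : X → ℝ) s (pertArgmin (f, s)) :=
  (ae_isPertMin_iff hη f).mono fun _ hs => (hs _).2 rfl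

lemma isPertArgmin_pertArgmin [CompactSpace X] [Nonempty X] {η : ℝ} (hη : 0 < η)
    (f : lipClass X) : IsPertArgmin η (f : X → ℝ) fun s => pertArgmin (f, s) :=
  ⟨(measurable_pertArgmin.comp measurable_prodMk_left).aemeasurable,
    ae_isPertMin_pertArgmin hη f⟩

/-- The law of the perturbed minimizer of `f`. -/
noncomputable def gradLaw [Nonempty X] (η : ℝ) (f : lipClass X) : Measure X :=
  (pertLaw d η).map fun s => pertArgmin (f, s)

lemma IsPertArgmin.map_eq [CompactSpace X] [Nonempty X] {η : ℝ} (hη : 0 < η) {f : lipClass X}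
    {xf : (Fin d → ℝ) → X} (h : IsPertArgmin η (f : X → ℝ) xf) :
    (pertLaw d η).map xf = gradLaw η f := by
  refine Measure.map_congr ?_
  filter_upwards [ae_isPertMin_iff hη f, h.2] with s hs hx
  exact (hs _).1 hx

lemma isProbabilityMeasure_gradLaw [CompactSpace X] [Nonempty X] {η : ℝ} (hη : 0 < η)
    (f : lipClass X) : IsProbabilityMeasure (gradLaw η f) := by
  have := isProbabilityMeasure_pertLaw d hη
  exact Measure.isProbabilityMeasure_map
    (measurable_pertArgmin.comp measurable_prodMk_left).aemeasurable

lemma measurable_gradLaw [CompactSpace X] [Nonempty X] {η : ℝ} (hη : 0 < η) :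
    Measurable (gradLaw η : lipClass X → Measure X) := by
  have := isProbabilityMeasure_pertLaw d hη
  have h : (gradLaw η : lipClass X → Measure X) =
      fun f => ((pertLaw d η).map (Prod.mk f)).map pertArgmin := by
    ext1 f
    rw [Measure.map_map measurable_pertArgmin measurable_prodMk_left]
    rfl
  rw [h]
  exact (Measure.measurable_map _ measurable_pertArgmin).comp Measurable.map_prodMk_left

lemma integral_gradLaw [CompactSpace X] [Nonempty X] (η : ℝ) (f : lipClass X) {h : X → ℝ}
    (hh : Continuous h) :
    ∫ x, h x ∂(gradLaw η f) = ∫ s, h (pertArgmin (f, s)) ∂(pertLaw d η) :=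
  integral_map (measurable_pertArgmin.comp measurable_prodMk_left).aemeasurable
    hh.aestronglyMeasurable

end Argmin

/-! ### Stability of the law of the perturbed minimizer -/

section Stability

open Set Filter Topology

variable {d : ℕ} {X : Set (Fin d → ℝ)}

lemma linPert_add_single (s : Fin d → ℝ) (i : Fin d) (c : ℝ) (x : X) :
    linPert X (s + Pi.single i c) x = linPert X s x + c * (x : Fin d → ℝ) i := by
  rw [linPert_add, Pi.add_apply, add_right_inj]
  simp [linPert, Pi.single_apply]

/-- Add the three optimality inequalities: x against y, y against y', and y' against x. All values
of the perturbation at s cancel, leaving c(x i - y' i) ≤ (f - g) y - (f - g) x. -/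
lemma IsPertMin.coord_shift_ge {f g : X → ℝ} {s : Fin d → ℝ} {i : Fin d} {c L : ℝ} {x y y' : X}
    (hfg : |(f - g) x - (f - g) y| ≤ L * l1Dist (x : Fin d → ℝ) y) (hx : IsPertMin f s x)
    (hy : IsPertMin g s y) (hy' : IsPertMin g (s + Pi.single i c) y') :
    c * ((x : Fin d → ℝ) i - (y' : Fin d → ℝ) i) ≤ L * l1Dist (x : Fin d → ℝ) y := by
  have h1 := hx y
  have h2 := hy y'
  have h3 := hy' x
  rw [linPert_add_single, linPert_add_single] at h3
  have h4 := (le_abs_self _).trans hfg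
  have h5 := (neg_le_abs _).trans hfg
  simp only [Pi.sub_apply] at h4 h5
  linarith

lemma max_coord_sub_le_min_coord_shift {f g : X → ℝ} {s : Fin d → ℝ} {i : Fin d} {c L : ℝ}
    (hc : 0 < c) (hL : 0 ≤ L) {x y x' y' : X}
    (hfg : |(f - g) x - (f - g) y| ≤ L * l1Dist (x : Fin d → ℝ) y) (hx : IsPertMin f s x)
    (hy : IsPertMin g s y) (hx' : IsPertMin f (s + Pi.single i c) x')
    (hy' : IsPertMin g (s + Pi.single i c) y') :
    max ((x : Fin d → ℝ) i) ((y : Fin d → ℝ) i) - L / c * l1Dist (x : Fin d → ℝ) y ≤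
      min ((x' : Fin d → ℝ) i) ((y' : Fin d → ℝ) i) := by
  have hgf : |(g - f) y - (g - f) x| ≤ L * l1Dist (y : Fin d → ℝ) x := by
    rw [l1Dist_comm]
    convert hfg using 1
    simp only [Pi.sub_apply]
    congr 1
    ring
  -- Comparing a function with itself gives monotonicity of its own minimizer's coordinate, with no
  -- slack.
  have hself : ∀ (h : X → ℝ) (z : X), |(h - h) z - (h - h) z| ≤ L * l1Dist (z : Fin d → ℝ) z :=
    fun h z => by simp [l1Dist_self]
  have h1 := hx.coord_shift_ge hfg hy hy'
  have h2 := hy.coord_shift_ge hgf hx hx'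
  have h3 := hx.coord_shift_ge (hself f x) hx hx'
  have h4 := hy.coord_shift_ge (hself g y) hy hy'
  rw [l1Dist_comm] at h2
  rw [l1Dist_self, mul_zero] at h3 h4
  have hnn := mul_nonneg hL (l1Dist_nonneg (x : Fin d → ℝ) y)
  have hq : L / c * l1Dist (x : Fin d → ℝ) y = L * l1Dist (x : Fin d → ℝ) y / c := by ring
  have key : ∀ a b : ℝ, c * (a - b) ≤ L * l1Dist (x : Fin d → ℝ) y →
      a ≤ b + L / c * l1Dist (x : Fin d → ℝ) y := fun a b h => by
    rw [hq, ← sub_le_iff_le_add', le_div_iff₀ hc]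
    linarith
  rw [sub_le_iff_le_add, max_le_iff, ← min_add_add_right, le_min_iff, le_min_iff]
  exact ⟨⟨key _ _ (h3.trans hnn), key _ _ h1⟩, ⟨key _ _ h2, key _ _ (h4.trans hnn)⟩⟩

lemma exists_coord_bounds [CompactSpace X] [Nonempty X] (i : Fin d) :
    ∃ a, ∀ x : X, a ≤ (x : Fin d → ℝ) i ∧ (x : Fin d → ℝ) i ≤ a + diam X := by
  have hc : Continuous fun x : X => (x : Fin d → ℝ) i :=
    (continuous_apply i).comp continuous_subtype_val
  obtain ⟨z, -, hz⟩ := isCompact_univ.exists_isMinOn univ_nonempty hc.continuousOn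
  refine ⟨(z : Fin d → ℝ) i, fun x => ⟨hz (mem_univ x), ?_⟩⟩
  have := (le_abs_self _).trans ((abs_coord_sub_le_l1Dist (x : Fin d → ℝ) z i).trans
    (l1Dist_le_diam x z))
  linarith

lemma measurable_pertArgmin_coord [CompactSpace X] [Nonempty X] (f : lipClass X) (i : Fin d) :
    Measurable fun s => (pertArgmin (f, s) : Fin d → ℝ) i :=
  (measurable_pi_apply i).comp (measurable_subtype_coe.comp
    (measurable_pertArgmin.comp measurable_prodMk_left))

lemma integrable_l1Dist_pertArgmin [CompactSpace X] [Nonempty X] {η : ℝ} (hη : 0 < η)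
    (f g : lipClass X) :
    Integrable (fun s => l1Dist (pertArgmin (f, s) : Fin d → ℝ) (pertArgmin (g, s)))
      (pertLaw d η) := by
  have := isProbabilityMeasure_pertLaw d hη
  refine Integrable.of_bound (Measurable.aestronglyMeasurable ?_) (diam X)
    (Eventually.of_forall fun s => ?_)
  · unfold l1Dist
    exact Finset.measurable_sum _ fun i _ => ((measurable_pertArgmin_coord f i).sub
      (measurable_pertArgmin_coord g i)).abs
  · rw [Real.norm_of_nonneg (l1Dist_nonneg _ _)]
    exact l1Dist_le_diam _ _

/-- The difference is the larger coordinate minus the smaller. The larger one is bounded through the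
smaller one at the shifted perturbation, whose expectation barely moves. L is only an upper bound so
that it can later be taken positive. -/
lemma integral_abs_coord_sub_le [CompactSpace X] [Nonempty X] {η : ℝ} (hη : 0 < η)
    (f g : lipClass X) {L c : ℝ} (hL : lipSemi (f.1 - g.1) ≤ L) (hc : 0 < c) (i : Fin d) :
    ∫ s, |(pertArgmin (f, s) : Fin d → ℝ) i - (pertArgmin (g, s) : Fin d → ℝ) i| ∂(pertLaw d η) ≤
      c / η * diam X +
        L / c * ∫ s, l1Dist (pertArgmin (f, s) : Fin d → ℝ) (pertArgmin (g, s)) ∂(pertLaw d η) := by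
  have := isProbabilityMeasure_pertLaw d hη
  obtain ⟨a, ha⟩ := exists_coord_bounds (X := X) i
  have hL0 : 0 ≤ L := (lipSemi_nonneg _).trans hL
  set xf : (Fin d → ℝ) → X := fun s => pertArgmin (f, s)
  set xg : (Fin d → ℝ) → X := fun s => pertArgmin (g, s)
  set lo : (Fin d → ℝ) → ℝ := fun s => min ((xf s : Fin d → ℝ) i) ((xg s : Fin d → ℝ) i)
  set hi : (Fin d → ℝ) → ℝ := fun s => max ((xf s : Fin d → ℝ) i) ((xg s : Fin d → ℝ) i)
  have hlom : Measurable lo :=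
    (measurable_pertArgmin_coord f i).min (measurable_pertArgmin_coord g i)
  have him : Measurable hi :=
    (measurable_pertArgmin_coord f i).max (measurable_pertArgmin_coord g i)
  have hlo : ∀ s, a ≤ lo s ∧ lo s ≤ a + diam X := fun s =>
    ⟨le_min (ha _).1 (ha _).1, (min_le_left _ _).trans (ha _).2⟩
  have hhi : ∀ s, a ≤ hi s ∧ hi s ≤ a + diam X := fun s =>
    ⟨(ha _).1.trans (le_max_left _ _), max_le (ha _).2 (ha _).2⟩
  have hint : ∀ u : (Fin d → ℝ) → ℝ, Measurable u → (∀ s, a ≤ u s ∧ u s ≤ a + diam X) →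
      Integrable u (pertLaw d η) := fun u hu hb =>
    Integrable.of_mem_Icc a (a + diam X) hu.aemeasurable (Eventually.of_forall hb)
  have hΔ := integrable_l1Dist_pertArgmin hη f g
  have hshift := quasiMeasurePreserving_shift hη hc.le i
  have hae : ∀ᵐ s ∂(pertLaw d η),
      hi s - L / c * l1Dist (xf s : Fin d → ℝ) (xg s) ≤ lo (s + Pi.single i c) := by
    have hf := ae_isPertMin_pertArgmin hη f
    have hg := ae_isPertMin_pertArgmin hη g
    filter_upwards [hf, hg, hshift.ae hf, hshift.ae hg] with s h1 h2 h3 h4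
    refine max_coord_sub_le_min_coord_shift hc hL0 ?_ h1 h2 h3 h4
    exact (abs_sub_le_lipSemi (sub_mem_lipClass f.2 g.2) _ _).trans
      (mul_le_mul_of_nonneg_right hL (l1Dist_nonneg _ _))
  have h1 := integral_mono_ae ((hint hi him hhi).sub (hΔ.const_mul (L / c)))
    (hint _ (hlom.comp (measurable_add_const _)) fun s => hlo _) hae
  simp only [Pi.sub_apply, Function.comp_apply] at h1
  rw [integral_sub (hint hi him hhi) (hΔ.const_mul (L / c)), integral_const_mul] at h1
  have h2 := integral_shift_sub_le hη hc.le i hlom (fun s => (hlo s).1) fun s => (hlo s).2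
  have h3 : ∫ s, |(xf s : Fin d → ℝ) i - (xg s : Fin d → ℝ) i| ∂(pertLaw d η) =
      ∫ s, hi s ∂(pertLaw d η) - ∫ s, lo s ∂(pertLaw d η) := by
    rw [← integral_sub (hint hi him hhi) (hint lo hlom hlo)]
    exact integral_congr_ae (Eventually.of_forall fun s => (max_sub_min_eq_abs' _ _).symm)
  rw [h3]
  linarith

lemma integral_l1Dist_pertArgmin_le [CompactSpace X] [Nonempty X] {η : ℝ} (hη : 0 < η)
    (f g : lipClass X) :
    ∫ s, l1Dist (pertArgmin (f, s) : Fin d → ℝ) (pertArgmin (g, s)) ∂(pertLaw d η) ≤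
      4 * ((d : ℝ) ^ 2 * diam X / η) * lipSemi (f.1 - g.1) := by
  have := isProbabilityMeasure_pertLaw d hη
  set Δ := ∫ s, l1Dist (pertArgmin (f, s) : Fin d → ℝ) (pertArgmin (g, s)) ∂(pertLaw d η) with hΔ
  have hsum : ∀ L c : ℝ, lipSemi (f.1 - g.1) ≤ L → 0 < c →
      Δ ≤ d * (c / η * diam X + L / c * Δ) := by
    intro L c hL hc
    calc Δ = ∑ i, ∫ s, |(pertArgmin (f, s) : Fin d → ℝ) i - (pertArgmin (g, s) : Fin d → ℝ) i|
          ∂(pertLaw d η) := by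
          refine integral_finsetSum _ fun i _ => ?_
          refine (integrable_l1Dist_pertArgmin hη f g).mono' (((measurable_pertArgmin_coord f i).sub
            (measurable_pertArgmin_coord g i)).abs.aestronglyMeasurable)
            (Eventually.of_forall fun s => ?_)
          rw [Real.norm_of_nonneg (abs_nonneg _)]
          exact abs_coord_sub_le_l1Dist _ _ i
      _ ≤ ∑ _i : Fin d, (c / η * diam X + L / c * Δ) :=
          Finset.sum_le_sum fun i _ => integral_abs_coord_sub_le hη f g hL hc i
      _ = _ := by rw [Finset.sum_const, Finset.card_univ, Fintype.card_fin, nsmul_eq_mul]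
  have hD := diam_nonneg (X := X)
  have hpos : ∀ L : ℝ, lipSemi (f.1 - g.1) ≤ L → 0 < L →
      Δ ≤ 4 * ((d : ℝ) ^ 2 * diam X / η) * L := by
    intro L hL hL0
    rcases Nat.eq_zero_or_pos d with hd | hd
    · subst hd
      have : Δ = 0 := by simp [hΔ, l1Dist]
      rw [this]
      positivity
    have hd' : (0 : ℝ) < d := Nat.cast_pos.2 hd
    -- This c makes the coefficient of Δ on the right equal to 1/2, so that Δ can be absorbed.
    have h := hsum L (2 * d * L) hL (by positivity)
    have e : (d : ℝ) * (2 * d * L / η * diam X + L / (2 * d * L) * Δ) =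
        2 * ((d : ℝ) ^ 2 * diam X / η) * L + Δ / 2 := by
      field_simp
    rw [e] at h
    linarith
  set K := 4 * ((d : ℝ) ^ 2 * diam X / η) with hK
  have hK0 : 0 ≤ K := by positivity
  -- The shift c must be positive, so a zero seminorm is reached as a limit of positive L.
  refine le_of_forall_pos_le_add fun ε hε => ?_
  have h := hpos (lipSemi (f.1 - g.1) + ε / (K + 1)) (le_add_of_nonneg_right (by positivity))
    (add_pos_of_nonneg_of_pos (lipSemi_nonneg _) (by positivity))
  have h2 : K * (ε / (K + 1)) ≤ ε := by
    rw [← mul_div_assoc, div_le_iff₀ (by positivity)]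
    nlinarith
  linarith

lemma ipm_gradLaw_le [CompactSpace X] [Nonempty X] {η : ℝ} (hη : 0 < η) (f g : lipClass X) :
    ipm (gradLaw η f) (gradLaw η g) ≤
      4 * ((d : ℝ) ^ 2 * diam X / η) * lipSemi (f.1 - g.1) := by
  have := isProbabilityMeasure_pertLaw d hη
  refine le_trans ?_ (integral_l1Dist_pertArgmin_le hη f g)
  refine ipm_le (integral_nonneg fun s => l1Dist_nonneg _ _) fun h hh h1 => ?_
  have hc := continuous_of_mem_lipClass hh
  have hint : ∀ u : lipClass X, Integrable (fun s => h (pertArgmin (u, s))) (pertLaw d η) :=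
    fun u => by
      have := isProbabilityMeasure_gradLaw hη u
      exact (integrable_map_measure hc.aestronglyMeasurable
        (measurable_pertArgmin.comp measurable_prodMk_left).aemeasurable).1
        (integrable_of_mem_lipClass hh (gradLaw η u))
  rw [integral_gradLaw η f hc, integral_gradLaw η g hc, ← integral_sub (hint f) (hint g)]
  refine (abs_integral_le_integral_abs).trans (integral_mono ((hint f).sub (hint g)).abs
    (integrable_l1Dist_pertArgmin hη f g) fun s => ?_)
  exact (abs_sub_le_lipSemi hh _ _).trans (mul_le_of_le_one_left (l1Dist_nonneg _ _) h1)

lemma isStable [CompactSpace X] [Nonempty X] {η : ℝ} (hη : 0 < η) :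
    IsStable X η (4 * ((d : ℝ) ^ 2 * diam X / η)) := by
  intro f hf g hg xf xg hxf hxg
  have h1 := IsPertArgmin.map_eq hη (f := ⟨f, hf⟩) hxf
  have h2 := IsPertArgmin.map_eq hη (f := ⟨g, hg⟩) hxg
  rw [h1, h2]
  exact ipm_gradLaw_le hη ⟨f, hf⟩ ⟨g, hg⟩

end Stability

/-! ### The potential: convexity, smoothness and the one-round inequality -/

section Potential

open Set Filter Topology

variable {d : ℕ} {X : Set (Fin d → ℝ)}

/-- The expected perturbed maximum, normalized to vanish at `0`. -/
noncomputable def pot (η : ℝ) (f : X → ℝ) : ℝ :=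
  ∫ s, (pertMax f s - pertMax (0 : X → ℝ) s) ∂(pertLaw d η)

lemma pot_zero (η : ℝ) : pot η (0 : X → ℝ) = 0 := by simp [pot]

lemma measurable_pertMax_right [CompactSpace X] [Nonempty X] (f : lipClass X) :
    Measurable fun s => pertMax (f : X → ℝ) s := by
  have := (measurable_pertMax (X := X)).comp (measurable_prodMk_left (x := f))
  simpa only [Function.comp_def] using this

/-- The difference of the two maxima is bounded by sup |f| for every perturbation, which is the
reason for the normalization at 0. -/
lemma integrable_pertMax_sub [CompactSpace X] [Nonempty X] {η : ℝ} (hη : 0 < η)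
    (f : lipClass X) :
    Integrable (fun s => pertMax (f : X → ℝ) s - pertMax (0 : X → ℝ) s) (pertLaw d η) := by
  have := isProbabilityMeasure_pertLaw d hη
  obtain ⟨B, hB⟩ := (isCompact_range (continuous_of_mem_lipClass f.2).abs).bddAbove
  have hB' : ∀ x, |(f : X → ℝ) x| ≤ B := fun x => hB ⟨x, rfl⟩
  refine Integrable.of_bound ((measurable_pertMax_right f).sub
    (measurable_pertMax_right ⟨0, zero_mem_lipClass⟩)).aestronglyMeasurable B
    (Eventually.of_forall fun s => ?_)
  obtain ⟨x, hx⟩ := exists_isPertMin f.2 s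
  obtain ⟨z, hz⟩ := exists_isPertMin (zero_mem_lipClass (X := X)) s
  have h1 := le_pertMax f.2 s z
  have h2 := le_pertMax (zero_mem_lipClass (X := X)) s x
  rw [hx.pertMax_eq] at h1 ⊢
  rw [hz.pertMax_eq] at h2 ⊢
  have h3 := abs_le.1 (hB' x)
  have h4 := abs_le.1 (hB' z)
  simp only [Pi.zero_apply] at h1 h2 ⊢
  rw [Real.norm_eq_abs, abs_le]
  constructor <;> linarith

/-- The subgradient inequality: the minimizer for v is a competitor in the maximum for u. -/
lemma pot_sub_integral_le [CompactSpace X] [Nonempty X] {η : ℝ} (hη : 0 < η)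
    (u v : lipClass X) :
    pot η (v : X → ℝ) - ∫ x, ((u : X → ℝ) x - (v : X → ℝ) x) ∂(gradLaw η v) ≤
      pot η (u : X → ℝ) := by
  have := isProbabilityMeasure_gradLaw hη v
  have hm := sub_mem_lipClass u.2 v.2
  have hc := continuous_of_mem_lipClass hm
  have hi : Integrable (fun s => (u.1 - v.1) (pertArgmin (v, s))) (pertLaw d η) :=
    (integrable_map_measure hc.aestronglyMeasurable
      (measurable_pertArgmin.comp measurable_prodMk_left).aemeasurable).1
      (integrable_of_mem_lipClass hm (gradLaw η v))
  have e := integral_gradLaw η v hc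
  simp only [Pi.sub_apply] at e hi
  rw [e, pot, pot, ← integral_sub (integrable_pertMax_sub hη v) hi]
  refine integral_mono_ae ((integrable_pertMax_sub hη v).sub hi) (integrable_pertMax_sub hη u) ?_
  filter_upwards [ae_isPertMin_pertArgmin hη v] with s hs
  have h1 := hs.pertMax_eq
  have h2 := le_pertMax u.2 s (pertArgmin (v, s))
  linarith

/-- Take y as competitor in the maximum for u. Its perturbation value falls short of the unpenalized
maximum by at most ‖σ‖ D. -/
lemma neg_pot_le [CompactSpace X] [Nonempty X] {η : ℝ} (hη : 0 < η) (u : lipClass X) (y : X) :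
    -pot η (u : X → ℝ) ≤
      (u : X → ℝ) y + diam X * ∫ s, lipSemi (linPert X s) ∂(pertLaw d η) := by
  have := isProbabilityMeasure_pertLaw d hη
  have hi := (integrable_lipSemi_linPert X hη).const_mul (diam X)
  rw [← integral_const_mul]
  have h := integral_mono ((integrable_const (-(u : X → ℝ) y)).sub hi)
    (integrable_pertMax_sub hη u) fun s => by
      have h1 := le_pertMax u.2 s y
      obtain ⟨z, hz⟩ := exists_isPertMin (zero_mem_lipClass (X := X)) s
      have h2 := hz.pertMax_eq
      have h3 := (le_abs_self _).trans (abs_sub_le_lipSemi (linPert_mem_lipClass (X := X) s) z y)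
      have h4 := mul_le_mul_of_nonneg_left (l1Dist_le_diam z y)
        (lipSemi_nonneg (linPert X s))
      simp only [Pi.sub_apply, Pi.zero_apply] at h2 ⊢
      linarith
  simp only [Pi.sub_apply] at h
  rw [integral_sub (integrable_const _) hi] at h
  simp only [integral_const, probReal_univ, one_smul] at h
  rw [pot]
  linarith

/-- Lipschitz continuity of the gradient makes the potential strongly convex in the dual sense. -/
lemma pot_sub_integral_add_sq_le [CompactSpace X] [Nonempty X] {η β : ℝ} (hη : 0 < η)
    (hβ0 : 0 ≤ β) (hβ : ∀ u v : lipClass X,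
      ipm (gradLaw η u) (gradLaw η v) ≤ β * lipSemi (u.1 - v.1))
    (g f : lipClass X) :
    pot η (f : X → ℝ) - ∫ x, ((g : X → ℝ) x - (f : X → ℝ) x) ∂(gradLaw η f)
      + (4 * β)⁻¹ * ipm (gradLaw η f) (gradLaw η g) ^ 2 ≤ pot η (g : X → ℝ) := by
  have hpf := isProbabilityMeasure_gradLaw hη f
  have hpg := isProbabilityMeasure_gradLaw hη g
  set ψ := pot η (g : X → ℝ) - (pot η (f : X → ℝ)
    - ∫ x, ((g : X → ℝ) x - (f : X → ℝ) x) ∂(gradLaw η f)) with hψ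
  have hψ0 : 0 ≤ ψ := sub_nonneg.2 (pot_sub_integral_le hη g f)
  set γ := ipm (gradLaw η f) (gradLaw η g) with hγ
  have hγ0 : 0 ≤ γ := ipm_nonneg _ _
  suffices h : (4 * β)⁻¹ * γ ^ 2 ≤ ψ by linarith
  -- For β = 0 the inverse is 0 by convention, and plain convexity suffices.
  rcases hβ0.eq_or_lt with h0 | hβpos
  · simpa [← h0] using hψ0
  rcases hγ0.eq_or_lt with h0 | hγpos
  · simpa [← h0] using hψ0
  -- Move from g to w = g - l h. The subgradient inequalities from f to w and from w to g add up to
  -- a bound with the law at w; stability replaces it by the law at g at cost β l².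
  have step : ∀ (l : ℝ), 0 < l → ∀ h ∈ lipClass X, lipSemi h ≤ 1 →
      l * (∫ x, h x ∂(gradLaw η f) - ∫ x, h x ∂(gradLaw η g)) ≤ ψ + β * l ^ 2 := by
    intro l hl h hh h1
    let w : lipClass X := ⟨(g : X → ℝ) - l • h, sub_mem_lipClass g.2 (smul_mem_lipClass l hh)⟩
    have hpw := isProbabilityMeasure_gradLaw hη w
    have i1 := pot_sub_integral_le hη g w
    have i2 := pot_sub_integral_le hη w f
    have e1 : ∫ x, ((g : X → ℝ) x - (w : X → ℝ) x) ∂(gradLaw η w) =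
        l * ∫ x, h x ∂(gradLaw η w) := by
      rw [← integral_const_mul]
      exact integral_congr_ae (Eventually.of_forall fun x => by simp [w])
    have e2 : ∫ x, ((w : X → ℝ) x - (f : X → ℝ) x) ∂(gradLaw η f) =
        ∫ x, ((g : X → ℝ) x - (f : X → ℝ) x) ∂(gradLaw η f) - l * ∫ x, h x ∂(gradLaw η f) := by
      rw [← integral_const_mul, ← integral_sub]
      · exact integral_congr_ae (Eventually.of_forall fun x => by simp [w]; ring)
      · exact integrable_of_mem_lipClass (sub_mem_lipClass g.2 f.2) _
      · exact (integrable_of_mem_lipClass hh _).const_mul l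
    have hsub : (w.1 - g.1) = (-l) • h := by ext x; simp [w]
    have i3 : ∫ x, h x ∂(gradLaw η w) - ∫ x, h x ∂(gradLaw η g) ≤ β * l := by
      refine (le_abs_self _).trans ((le_ipm hh h1 _ _).trans ((hβ w g).trans ?_))
      refine mul_le_mul_of_nonneg_left ?_ hβ0
      rw [hsub]
      refine (lipSemi_smul_le _ hh).trans ?_
      rw [abs_neg, abs_of_pos hl]
      exact mul_le_of_le_one_right hl.le h1
    have i4 := mul_le_mul_of_nonneg_left i3 hl.le
    rw [e1] at i1
    rw [e2] at i2
    have : l * (β * l) = β * l ^ 2 := by ring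
    linarith
  -- This l maximizes l γ - β l², with maximum γ² / (4β).
  have hl : 0 < γ / (2 * β) := by positivity
  have hsup : γ ≤ (ψ + β * (γ / (2 * β)) ^ 2) / (γ / (2 * β)) := by
    refine ipm_le (by positivity) fun h hh h1 => ?_
    rw [le_div_iff₀' hl]
    have hneg : lipSemi (-h) ≤ 1 := by
      have := lipSemi_smul_le (-1) hh
      simp only [neg_smul, one_smul, abs_neg, abs_one, one_mul] at this
      exact this.trans h1
    have s1 := step _ hl h hh h1
    have s2 := step _ hl (-h) (neg_mem_lipClass hh) hneg
    simp only [Pi.neg_apply, integral_neg] at s2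
    rcases abs_choice (∫ x, h x ∂(gradLaw η f) - ∫ x, h x ∂(gradLaw η g)) with e | e <;> rw [e]
    · exact s1
    · refine le_trans (le_of_eq ?_) s2
      ring
  rw [le_div_iff₀ hl] at hsup
  have e : (4 * β)⁻¹ * γ ^ 2 = γ * (γ / (2 * β)) - β * (γ / (2 * β)) ^ 2 := by
    field_simp
    ring
  linarith

/-- Here u is the past, v the point played from, and w the past including the new loss. The
sharpened inequality at v pays for the guess and plain convexity at w pays for f - g under the law
at w. Changing that law to the one at v costs ‖f - g‖ times their distance, at most β‖f - g‖². -/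
lemma integral_gradLaw_le [CompactSpace X] [Nonempty X] {η β : ℝ} (hη : 0 < η)
    (hβ0 : 0 ≤ β) (hβ : ∀ u v : lipClass X,
      ipm (gradLaw η u) (gradLaw η v) ≤ β * lipSemi (u.1 - v.1))
    (f g u v w : lipClass X) (hv : v.1 = u.1 + g.1) (hw : w.1 = u.1 + f.1) :
    ∫ x, (f : X → ℝ) x ∂(gradLaw η v) ≤ pot η (u : X → ℝ) - pot η (w : X → ℝ)
      + β * lipSemi (f.1 - g.1) ^ 2
      - (4 * β)⁻¹ * ipm (gradLaw η v) (gradLaw η u) ^ 2 := by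
  have hpv := isProbabilityMeasure_gradLaw hη v
  have hpw := isProbabilityMeasure_gradLaw hη w
  have h1 := pot_sub_integral_add_sq_le hη hβ0 hβ u v
  have h2 := pot_sub_integral_le hη v w
  have e1 : ∫ x, ((u : X → ℝ) x - (v : X → ℝ) x) ∂(gradLaw η v) =
      -∫ x, (g : X → ℝ) x ∂(gradLaw η v) := by
    rw [← integral_neg]
    exact integral_congr_ae (Eventually.of_forall fun x => by simp [hv])
  have e2 : ∫ x, ((v : X → ℝ) x - (w : X → ℝ) x) ∂(gradLaw η w) =
      -∫ x, (f.1 - g.1) x ∂(gradLaw η w) := by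
    rw [← integral_neg]
    exact integral_congr_ae (Eventually.of_forall fun x => by simp [hv, hw])
  have h3 := (le_abs_self _).trans (abs_integral_sub_le_lipSemi_mul_ipm
    (sub_mem_lipClass f.2 g.2) (gradLaw η v) (gradLaw η w))
  have h4 : ipm (gradLaw η v) (gradLaw η w) ≤ β * lipSemi (f.1 - g.1) := by
    rw [ipm_comm]
    refine (hβ w v).trans (le_of_eq ?_)
    rw [hv, hw, add_sub_add_left_eq_sub]
  have h5 := mul_le_mul_of_nonneg_left h4 (lipSemi_nonneg (f.1 - g.1))
  have e3 : ∫ x, (f.1 - g.1) x ∂(gradLaw η v) =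
      ∫ x, (f : X → ℝ) x ∂(gradLaw η v) - ∫ x, (g : X → ℝ) x ∂(gradLaw η v) :=
    integral_sub (integrable_of_mem_lipClass f.2 _) (integrable_of_mem_lipClass g.2 _)
  have e4 : lipSemi (f.1 - g.1) * (β * lipSemi (f.1 - g.1)) =
    β * lipSemi (f.1 - g.1) ^ 2 := by ring
  linarith

end Potential

/-! ### Freezing an independent variable -/

section Independence

open Set Filter Topology

lemma integrable_and_integral_eq_of_indepFun {Ω β E : Type*} [MeasurableSpace Ω]
    [MeasurableSpace β] [MeasurableSpace E] {μ : Measure Ω} [IsProbabilityMeasure μ]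
    {W : Ω → β} {S : Ω → E} (hW : Measurable W) (hS : Measurable S) (hind : IndepFun W S μ)
    {h : β × E → ℝ} (hh : Measurable h) (hi : Integrable (fun ω => h (W ω, S ω)) μ) :
    Integrable (fun ω => ∫ s, h (W ω, s) ∂(μ.map S)) μ ∧
      ∫ ω, h (W ω, S ω) ∂μ = ∫ ω, ∫ s, h (W ω, s) ∂(μ.map S) ∂μ := by
  have hWS : Measurable fun ω => (W ω, S ω) := hW.prodMk hS
  have := Measure.isProbabilityMeasure_map (μ := μ) hW.aemeasurable
  have := Measure.isProbabilityMeasure_map (μ := μ) hS.aemeasurable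
  have hprod := (indepFun_iff_map_prod_eq_prod_map_map hW.aemeasurable hS.aemeasurable).1 hind
  have hi' : Integrable h ((μ.map W).prod (μ.map S)) := by
    rw [← hprod]
    exact (integrable_map_measure hh.aestronglyMeasurable hWS.aemeasurable).2 hi
  refine ⟨hi'.integral_prod_left.comp_measurable hW, ?_⟩
  rw [← integral_map (f := h) hWS.aemeasurable hh.aestronglyMeasurable, hprod, integral_prod _ hi',
    integral_map hW.aemeasurable hi'.integral_prod_left.aestronglyMeasurable]

/-- Turns an almost sure statement for each fixed w into one for random w. Joint measurability of
the exceptional set is essential here. -/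
lemma ae_of_indepFun {Ω β E : Type*} [MeasurableSpace Ω]
    [MeasurableSpace β] [MeasurableSpace E] {μ : Measure Ω} [IsProbabilityMeasure μ]
    {W : Ω → β} {S : Ω → E} (hW : Measurable W) (hS : Measurable S) (hind : IndepFun W S μ)
    {A : Set (β × E)} (hA : MeasurableSet A) (h : ∀ w, ∀ᵐ s ∂(μ.map S), (w, s) ∈ A) :
    ∀ᵐ ω ∂μ, (W ω, S ω) ∈ A := by
  have hWS : Measurable fun ω => (W ω, S ω) := hW.prodMk hS
  have := Measure.isProbabilityMeasure_map (μ := μ) hW.aemeasurable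
  have := Measure.isProbabilityMeasure_map (μ := μ) hS.aemeasurable
  have hprod := (indepFun_iff_map_prod_eq_prod_map_map hW.aemeasurable hS.aemeasurable).1 hind
  have h1 := (Measure.ae_prod_mem_iff_ae_ae_mem (μ := μ.map W) (ν := μ.map S) hA).2
    (Eventually.of_forall h)
  rw [← hprod] at h1
  exact ae_of_ae_map hWS.aemeasurable h1

lemma indepFun_of_measurable_of_indep {Ω β E : Type*} [mΩ : MeasurableSpace Ω]
    [MeasurableSpace β] [MeasurableSpace E] {μ : Measure Ω} {𝒢 𝒮 : MeasurableSpace Ω}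
    {W : Ω → β} {S : Ω → E} (hW : Measurable[𝒢] W) (hS : Measurable[𝒮] S)
    (hind : Indep 𝒮 𝒢 μ) : IndepFun W S μ := by
  rw [IndepFun_iff_Indep]
  exact indep_of_indep_of_le_left (indep_of_indep_of_le_right hind.symm hS.comap_le) hW.comap_le

/-- Two families of probability measures that agree almost surely on each measurable set agree
almost surely. -/
lemma ae_eq_of_forall_real_ae_eq {Ω E : Type*} [MeasurableSpace Ω] [mE : MeasurableSpace E]
    [hE : MeasurableSpace.CountablyGenerated E] {μ : Measure Ω} {P Q : Ω → Measure E}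
    (hP : ∀ ω, IsProbabilityMeasure (P ω)) (hQ : ∀ ω, IsProbabilityMeasure (Q ω))
    (h : ∀ B, MeasurableSet B → ∀ᵐ ω ∂μ, (P ω).real B = (Q ω).real B) :
    ∀ᵐ ω ∂μ, P ω = Q ω := by
  obtain ⟨𝒜, hc, hgen⟩ := hE.isCountablyGenerated
  have hgen' : mE = MeasurableSpace.generateFrom (generateSetAlgebra 𝒜) := by
    rw [generateFrom_generateSetAlgebra_eq, hgen]
  have hm : ∀ B ∈ generateSetAlgebra 𝒜, MeasurableSet B := fun B hB => by
    rw [hgen']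
    exact MeasurableSpace.measurableSet_generateFrom hB
  have hall : ∀ᵐ ω ∂μ, ∀ B ∈ generateSetAlgebra 𝒜, (P ω).real B = (Q ω).real B :=
    (ae_ball_iff (countable_generateSetAlgebra hc)).2 fun B hB => h B (hm B hB)
  filter_upwards [hall] with ω hω
  have := hP ω
  have := hQ ω
  refine ext_of_generate_finite _ hgen' isSetAlgebra_generateSetAlgebra.isSetRing.isSetSemiring.isPiSystem
    (fun B hB => ?_) (by simp)
  rw [← ENNReal.toReal_eq_toReal_iff' (measure_ne_top _ _) (measure_ne_top _ _)]
  exact hω B hB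

end Independence

/-! ### Joint measurability in the loss and the perturbation -/

section JointMeasurability

open Set Filter Topology

variable {d : ℕ} {X : Set (Fin d → ℝ)}

/-- A Carathéodory function: continuous in the point, measurable in the function. -/
lemma measurable_eval : Measurable fun p : lipClass X × X => p.1.1 p.2 := by
  have h : Measurable (Function.uncurry fun (x : X) (f : lipClass X) => f.1 x) :=
    measurable_uncurry_of_continuous_of_measurable (fun f => continuous_of_mem_lipClass f.2)
      fun x => (measurable_pi_apply x).comp measurable_subtype_coe
  exact h.comp measurable_swap

lemma measurable_linPert : Measurable fun p : (Fin d → ℝ) × X => linPert X p.1 p.2 := by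
  unfold linPert
  refine Finset.measurable_sum _ fun i _ => ?_
  exact ((measurable_pi_apply i).comp measurable_fst).mul
    ((measurable_pi_apply i).comp (measurable_subtype_coe.comp measurable_snd))

/-- The gap between the forward and the backward difference quotient of `pertMax`. -/
noncomputable def quotGap (p : lipClass X × (Fin d → ℝ)) (i : Fin d) (n : ℕ) : ℝ :=
  ((1 : ℝ) / (n + 1))⁻¹ *
      (pertMax p.1.1 (p.2 + Pi.single i ((1 : ℝ) / (n + 1))) - pertMax p.1.1 p.2) -
    (-((1 : ℝ) / (n + 1)))⁻¹ *
      (pertMax p.1.1 (p.2 + Pi.single i (-((1 : ℝ) / (n + 1)))) - pertMax p.1.1 p.2)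

lemma measurable_quotGap [CompactSpace X] [Nonempty X] (i : Fin d) (n : ℕ) :
    Measurable fun p : lipClass X × (Fin d → ℝ) => quotGap p i n := by
  have hq : ∀ c : ℝ, Measurable fun p : lipClass X × (Fin d → ℝ) =>
      pertMax p.1.1 (p.2 + Pi.single i c) := fun c => by
    have hs : Measurable fun p : lipClass X × (Fin d → ℝ) => (p.1, p.2 + Pi.single i c) :=
      measurable_fst.prodMk (measurable_snd.add_const _)
    have := (measurable_pertMax (X := X)).comp hs
    simpa only [Function.comp_def] using this
  exact (((hq _).sub measurable_pertMax).const_mul _).sub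
    (((hq _).sub measurable_pertMax).const_mul _)

lemma IsPertMin.mul_coord_le [CompactSpace X] {f : X → ℝ} (hf : f ∈ lipClass X) {s : Fin d → ℝ}
    {x : X} (hx : IsPertMin f s x) (i : Fin d) (c : ℝ) :
    c * (x : Fin d → ℝ) i ≤ pertMax f (s + Pi.single i c) - pertMax f s := by
  have h := le_pertMax hf (s + Pi.single i c) x
  rw [linPert_add_single] at h
  rw [hx.pertMax_eq]
  linarith

/-- Coordinates of minimizers are subgradients of a convex function: the forward quotient bounds x i
above, the backward one bounds y i below. Arbitrarily small gaps thus force uniqueness, using only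
countably many measurable conditions. -/
lemma IsPertMin.coord_sub_le_quotGap [CompactSpace X] {f : lipClass X} {s : Fin d → ℝ} {x y : X}
    (hx : IsPertMin f.1 s x) (hy : IsPertMin f.1 s y) (i : Fin d) (n : ℕ) :
    (x : Fin d → ℝ) i - (y : Fin d → ℝ) i ≤ quotGap (f, s) i n := by
  have hc : (0 : ℝ) < 1 / (n + 1) := by positivity
  have h1 := mul_le_mul_of_nonneg_left (hx.mul_coord_le f.2 i (1 / (n + 1))) (inv_pos.2 hc).le
  have h2 := mul_le_mul_of_nonneg_left (hy.mul_coord_le f.2 i (-(1 / (n + 1)))) (inv_pos.2 hc).le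
  rw [inv_mul_cancel_left₀ hc.ne'] at h1
  rw [neg_mul, mul_neg, inv_mul_cancel_left₀ hc.ne'] at h2
  rw [quotGap, inv_neg, neg_mul]
  linarith

/-- A measurable set of pairs on which the perturbed minimizer is unique and equal to
`pertArgmin`. -/
def goodPairs (X : Set (Fin d → ℝ)) [Nonempty X] : Set (lipClass X × (Fin d → ℝ)) :=
  {p | ∀ (i : Fin d) (k : ℕ), ∃ n : ℕ, quotGap p i n < 1 / ((k : ℝ) + 1)} ∩
    {p | pertMax p.1.1 p.2 = linPert X p.2 (pertArgmin p) - p.1.1 (pertArgmin p)}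

lemma measurableSet_goodPairs [CompactSpace X] [Nonempty X] : MeasurableSet (goodPairs X) := by
  refine MeasurableSet.inter ?_ (measurableSet_eq_fun measurable_pertMax ?_)
  · simp only [Set.ofPred_forall, Set.ofPred_exists]
    exact MeasurableSet.iInter fun i => MeasurableSet.iInter fun k => MeasurableSet.iUnion fun n =>
      measurableSet_lt (measurable_quotGap i n) measurable_const
  · exact (measurable_linPert.comp (measurable_snd.prodMk measurable_pertArgmin)).sub
      (measurable_eval.comp (measurable_fst.prodMk measurable_pertArgmin))

lemma eq_pertArgmin_of_mem_goodPairs [CompactSpace X] [Nonempty X] {f : lipClass X}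
    {s : Fin d → ℝ} (h : (f, s) ∈ goodPairs X) {x : X} (hx : IsPertMin f.1 s x) :
    x = pertArgmin (f, s) := by
  have hy : IsPertMin f.1 s (pertArgmin (f, s)) := fun z => by
    have h1 : pertMax f.1 s = _ := h.2
    have h2 := le_pertMax f.2 s z
    simp only at h1
    linarith
  have key : ∀ {x y : X}, IsPertMin f.1 s x → IsPertMin f.1 s y → ∀ i,
      (x : Fin d → ℝ) i ≤ (y : Fin d → ℝ) i := by
    intro x y hx hy i
    refine le_of_forall_pos_le_add fun ε hε => ?_
    obtain ⟨k, hk⟩ := exists_nat_one_div_lt hε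
    obtain ⟨n, hn⟩ := h.1 i k
    linarith [hx.coord_sub_le_quotGap hy i n]
  ext i
  exact le_antisymm (key hx hy i) (key hy hx i)

lemma ae_mem_goodPairs [CompactSpace X] [Nonempty X] {η : ℝ} (hη : 0 < η) (f : lipClass X) :
    ∀ᵐ s ∂(pertLaw d η), (f, s) ∈ goodPairs X := by
  obtain ⟨K, hK⟩ := exists_lipschitzWith_pertMax f.2
  filter_upwards [(pertLaw_absolutelyContinuous d hη).ae_le
    (hK.ae_differentiableAt (μ := volume)), ae_isPertMin_pertArgmin hη f] with s hs hmin
  refine ⟨fun i k => ?_, hmin.pertMax_eq⟩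
  have h0 : Tendsto (fun n : ℕ => (1 : ℝ) / (n + 1)) atTop (𝓝[≠] 0) :=
    tendsto_nhdsWithin_iff.2 ⟨tendsto_one_div_add_atTop_nhds_zero_nat,
      Eventually.of_forall fun n => by simp; positivity⟩
  have h0' : Tendsto (fun n : ℕ => -((1 : ℝ) / (n + 1))) atTop (𝓝[≠] 0) :=
    tendsto_nhdsWithin_iff.2 ⟨by simpa using (tendsto_one_div_add_atTop_nhds_zero_nat (𝕜 := ℝ)).neg,
      Eventually.of_forall fun n => by simp; positivity⟩
  have hd := (hs.hasFDerivAt.hasLineDerivAt (Pi.single i 1)).tendsto_slope_zero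
  have hlim := (hd.comp h0).sub (hd.comp h0')
  rw [sub_self] at hlim
  obtain ⟨n, hn⟩ := (hlim.eventually_lt_const (show (0 : ℝ) < 1 / ((k : ℝ) + 1) by
    positivity)).exists
  refine ⟨n, ?_⟩
  simpa only [quotGap, Function.comp_apply, smul_eq_mul, ← Pi.single_smul, mul_one] using hn

/-- The adaptive objective is random, so uniqueness for each fixed f is lifted through `goodPairs`.
-/
lemma ae_eq_pertArgmin [CompactSpace X] [Nonempty X] {η : ℝ} (hη : 0 < η) {Ω : Type*}
    [MeasurableSpace Ω] {μ : Measure Ω} [IsProbabilityMeasure μ] {v : Ω → lipClass X}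
    {S : Ω → Fin d → ℝ} (hv : Measurable v) (hS : Measurable S) (hlaw : μ.map S = pertLaw d η)
    (hind : IndepFun v S μ) {x : Ω → X} (hx : ∀ᵐ ω ∂μ, IsPertMin (v ω).1 (S ω) (x ω)) :
    ∀ᵐ ω ∂μ, x ω = pertArgmin (v ω, S ω) := by
  have h := ae_of_indepFun hv hS hind measurableSet_goodPairs
    (fun f => by rw [hlaw]; exact ae_mem_goodPairs hη f)
  filter_upwards [h, hx] with ω h1 h2
  exact eq_pertArgmin_of_mem_goodPairs h1 h2

lemma abs_continuousMap_integral_sub_le {E : Type*} [TopologicalSpace E] [CompactSpace E]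
    [MeasurableSpace E] [BorelSpace E] (P : Measure E) [IsProbabilityMeasure P] (f g : C(E, ℝ)) :
    |∫ x, f x ∂P - ∫ x, g x ∂P| ≤ dist f g := by
  have hi : ∀ f : C(E, ℝ), Integrable f P := fun f =>
    f.continuous.integrable_of_hasCompactSupport (HasCompactSupport.of_compactSpace f)
  rw [← integral_sub (hi f) (hi g)]
  have := norm_integral_le_of_norm_le_const (μ := P) (f := fun x => f x - g x) (C := dist f g)
    (Eventually.of_forall fun x => by
      rw [← dist_eq_norm]; exact ContinuousMap.dist_apply_le_dist x)
  simpa using this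

lemma measurable_ipm_gradLaw [CompactSpace X] [Nonempty X] {η : ℝ} (hη : 0 < η) :
    Measurable fun p : lipClass X × lipClass X => ipm (gradLaw η p.1) (gradLaw η p.2) := by
  have := isProbabilityMeasure_pertLaw d hη
  -- The unit ball is separable in the uniform norm and integrals are uniformly continuous in it, so
  -- a countable family of test functions attains the supremum.
  let 𝒰 : Set C(X, ℝ) := {h | (h : X → ℝ) ∈ lipClass X ∧ lipSemi (h : X → ℝ) ≤ 1}
  have hne : Nonempty 𝒰 := ⟨⟨0, zero_mem_lipClass, lipSemi_le zero_le_one fun x y => by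
    simpa using l1Dist_nonneg (x : Fin d → ℝ) y⟩⟩
  have hm : ∀ h : C(X, ℝ), Measurable fun f : lipClass X => ∫ x, h x ∂(gradLaw η f) := by
    intro h
    simp only [integral_gradLaw η _ h.continuous]
    exact (StronglyMeasurable.integral_prod_right
      (f := fun (f : lipClass X) s => h (pertArgmin (f, s)))
      (h.continuous.measurable.comp measurable_pertArgmin).stronglyMeasurable).measurable
  let u : ℕ → 𝒰 := TopologicalSpace.denseSeq 𝒰
  have hm' : ∀ n, Measurable fun p : lipClass X × lipClass X =>
      |∫ x, (u n).1 x ∂(gradLaw η p.1) - ∫ x, (u n).1 x ∂(gradLaw η p.2)| := fun n =>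
    (((hm _).comp measurable_fst).sub ((hm _).comp measurable_snd)).abs
  refine Measurable.isLUB hm' fun p => ?_
  have := isProbabilityMeasure_gradLaw hη p.1
  have := isProbabilityMeasure_gradLaw hη p.2
  refine ⟨?_, fun b hb => ?_⟩
  · rintro _ ⟨n, rfl⟩
    exact le_ipm (u n).2.1 (u n).2.2 _ _
  · have hb' : ∀ n, |∫ x, (u n).1 x ∂(gradLaw η p.1) - ∫ x, (u n).1 x ∂(gradLaw η p.2)| ≤ b :=
      fun n => hb ⟨n, rfl⟩
    refine ipm_le ((abs_nonneg _).trans (hb' 0)) fun h hh h1 => ?_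
    let h' : 𝒰 := ⟨⟨h, continuous_of_mem_lipClass hh⟩, hh, h1⟩
    refine le_of_forall_pos_le_add fun ε hε => ?_
    obtain ⟨n, hn⟩ := (TopologicalSpace.denseRange_denseSeq 𝒰).exists_dist_lt h'
      (half_pos hε)
    have a1 := abs_continuousMap_integral_sub_le (gradLaw η p.1) h'.1 (u n).1
    have a2 := abs_continuousMap_integral_sub_le (gradLaw η p.2) h'.1 (u n).1
    have hn' : dist h'.1 (u n).1 < ε / 2 := hn
    have b1 := abs_le.1 (a1.trans hn'.le)
    have b2 := abs_le.1 (a2.trans hn'.le)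
    have b3 := abs_le.1 (hb' n)
    have e : ∀ P : Measure X, ∫ x, h'.1 x ∂P = ∫ x, h x ∂P := fun _ => rfl
    rw [e] at b1 b2
    rw [abs_le]
    constructor <;> linarith [b1.1, b1.2, b2.1, b2.2, b3.1, b3.2]

end JointMeasurability

/-! ### One round: conditional laws and sampling -/

section Round

open Set Filter Topology

variable {d : ℕ} {X : Set (Fin d → ℝ)}

lemma empirical_real {E Ω : Type*} [MeasurableSpace E] {m : ℕ} (x : Fin m → Ω → E) (ω : Ω)
    {B : Set E} (hB : MeasurableSet B) :
    (empirical x ω).real B = (m : ℝ)⁻¹ * ∑ j, B.indicator (fun _ => (1 : ℝ)) (x j ω) := by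
  rw [empirical, measureReal_ennreal_smul_apply, ENNReal.toReal_inv, ENNReal.toReal_natCast,
    measureReal_def, Measure.finsetSum_apply, ENNReal.toReal_sum fun j _ => measure_ne_top _ _]
  congr 1
  refine Finset.sum_congr rfl fun j _ => ?_
  rw [Measure.dirac_apply' _ hB]
  by_cases h : x j ω ∈ B <;> simp [h]

lemma measurable_empirical {E Ω : Type*} [MeasurableSpace E] {mΩ : MeasurableSpace Ω} {m : ℕ}
    {x : Fin m → Ω → E} (hx : ∀ j, Measurable (x j)) : Measurable (empirical x) := by
  refine Measure.measurable_of_measurable_coe _ fun B hB => ?_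
  simp only [empirical, Measure.smul_apply, Measure.finsetSum_apply, smul_eq_mul]
  refine Measurable.const_mul (Finset.measurable_sum _ fun j _ => ?_) _
  simp only [Measure.dirac_apply' _ hB]
  exact (measurable_one.indicator hB).comp (hx j)

/-- In effect, the conditional law of x given 𝒢 is `gradLaw η (v ω)`, in the form tested against
𝒢-measurable W. -/
lemma integral_comp_pertMin [CompactSpace X] [Nonempty X] {η : ℝ} (hη : 0 < η) {Ω β : Type*}
    {𝒢 : MeasurableSpace Ω} [mΩ : MeasurableSpace Ω] [MeasurableSpace β] {μ : Measure Ω}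
    [IsProbabilityMeasure μ] (h𝒢 : 𝒢 ≤ mΩ) {W : Ω → β} {v : Ω → lipClass X} {S : Ω → Fin d → ℝ}
    (hW : Measurable[𝒢] W) (hv : Measurable[𝒢] v) (hS : Measurable S)
    (hlaw : μ.map S = pertLaw d η) (hind : Indep (MeasurableSpace.comap S inferInstance) 𝒢 μ)
    {x : Ω → X} (hx : ∀ᵐ ω ∂μ, IsPertMin (v ω).1 (S ω) (x ω)) {φ : β × X → ℝ}
    (hφ : Measurable φ) (hi : Integrable (fun ω => φ (W ω, x ω)) μ) :
    Integrable (fun ω => ∫ z, φ (W ω, z) ∂(gradLaw η (v ω))) μ ∧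
      ∫ ω, φ (W ω, x ω) ∂μ = ∫ ω, ∫ z, φ (W ω, z) ∂(gradLaw η (v ω)) ∂μ := by
  have hvS : IndepFun v S μ := indepFun_of_measurable_of_indep hv (comap_measurable S) hind
  have hWv : Measurable[𝒢] fun ω => (v ω, W ω) := hv.prodMk hW
  have hWS : IndepFun (fun ω => (v ω, W ω)) S μ :=
    indepFun_of_measurable_of_indep hWv (comap_measurable S) hind
  have hae := ae_eq_pertArgmin hη (hv.mono h𝒢 le_rfl) hS hlaw hvS hx
  have hae' : (fun ω => φ (W ω, x ω)) =ᵐ[μ] fun ω => φ (W ω, pertArgmin (v ω, S ω)) := by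
    filter_upwards [hae] with ω hω
    rw [hω]
  have hh : Measurable fun p : (lipClass X × β) × (Fin d → ℝ) =>
      φ (p.1.2, pertArgmin (p.1.1, p.2)) :=
    hφ.comp ((measurable_snd.comp measurable_fst).prodMk (measurable_pertArgmin.comp
      ((measurable_fst.comp measurable_fst).prodMk measurable_snd)))
  have key := integrable_and_integral_eq_of_indepFun (hWv.mono h𝒢 le_rfl) hS hWS hh
    (hi.congr hae')
  have e : ∀ ω, ∫ s, φ (W ω, pertArgmin (v ω, s)) ∂(μ.map S) =
      ∫ z, φ (W ω, z) ∂(gradLaw η (v ω)) := fun ω => by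
    rw [hlaw, gradLaw]
    exact (integral_map (f := fun z => φ (W ω, z))
      (measurable_pertArgmin.comp measurable_prodMk_left).aemeasurable
      (hφ.comp measurable_prodMk_left).aestronglyMeasurable).symm
  simp only [e] at key
  rw [integral_congr_ae hae']
  exact key

lemma IsCondExpMeasure.ae_eq_gradLaw [CompactSpace X] [Nonempty X] {η : ℝ} (hη : 0 < η)
    {Ω : Type*} {𝒢 : MeasurableSpace Ω} [mΩ : MeasurableSpace Ω] {μ : Measure Ω}
    [IsProbabilityMeasure μ] (h𝒢 : 𝒢 ≤ mΩ) {m : ℕ} (hm : m ≠ 0) {v : Ω → lipClass X}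
    {S : Fin m → Ω → Fin d → ℝ} (hv : Measurable[𝒢] v) (hS : ∀ j, Measurable (S j))
    (hlaw : ∀ j, μ.map (S j) = pertLaw d η)
    (hind : ∀ j, Indep (MeasurableSpace.comap (S j) inferInstance) 𝒢 μ)
    {x : Fin m → Ω → X} (hxm : ∀ j, Measurable (x j))
    (hx : ∀ j, ∀ᵐ ω ∂μ, IsPertMin (v ω).1 (S j ω) (x j ω)) {Q : Ω → Measure X}
    (hQ : IsCondExpMeasure μ 𝒢 (empirical x) Q) : ∀ᵐ ω ∂μ, Q ω = gradLaw η (v ω) := by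
  have hgp : ∀ f : lipClass X, IsProbabilityMeasure (gradLaw η f) :=
    isProbabilityMeasure_gradLaw hη
  refine ae_eq_of_forall_real_ae_eq hQ.prob (fun ω => hgp _) fun B hB => ?_
  have hind1 : ∀ A : Set Ω, MeasurableSet A → ∀ j,
      Integrable (fun ω => A.indicator (fun _ => (1 : ℝ)) ω *
        B.indicator (fun _ => (1 : ℝ)) (x j ω)) μ := fun A hA j => by
    refine Integrable.of_bound (((measurable_const.indicator hA).mul
      ((measurable_const.indicator hB).comp (hxm j))).aestronglyMeasurable) 1
      (Eventually.of_forall fun ω => ?_)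
    by_cases h1 : ω ∈ A <;> by_cases h2 : x j ω ∈ B <;> simp [h1, h2]
  have hgm : Measurable[𝒢] fun ω => (gradLaw η (v ω)).real B :=
    ((Measure.measurable_coe hB).comp ((measurable_gradLaw hη).comp hv)).ennreal_toReal
  have hgi : Integrable (fun ω => (gradLaw η (v ω)).real B) μ :=
    Integrable.of_bound (hgm.mono h𝒢 le_rfl).aestronglyMeasurable 1
      (Eventually.of_forall fun ω => by
        rw [Real.norm_of_nonneg measureReal_nonneg]; exact measureReal_le_one)
  -- The defining property of conditional expectation, obtained with W the indicator of A. It is the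
  -- same for every j, so averaging over the samples changes nothing.
  have hset : ∀ A : Set Ω, MeasurableSet[𝒢] A → ∀ j,
      ∫ ω in A, B.indicator (fun _ => (1 : ℝ)) (x j ω) ∂μ =
        ∫ ω in A, (gradLaw η (v ω)).real B ∂μ := by
    intro A hA j
    have hφ : Measurable fun p : ℝ × X => p.1 * B.indicator (fun _ => (1 : ℝ)) p.2 :=
      measurable_fst.mul ((measurable_const.indicator hB).comp measurable_snd)
    have hAm : Measurable[𝒢] (A.indicator fun _ => (1 : ℝ)) := measurable_const.indicator hA
    have h := (integral_comp_pertMin hη h𝒢 hAm hv (hS j) (hlaw j) (hind j) (hx j) hφ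
      (hind1 A (h𝒢 A hA) j)).2
    rw [← integral_indicator (h𝒢 A hA), ← integral_indicator (h𝒢 A hA)]
    convert h using 2
    · ext ω
      by_cases h1 : ω ∈ A <;> simp [h1]
    · ext ω
      simp only [integral_const_mul]
      rw [integral_indicator_const _ hB]
      by_cases h1 : ω ∈ A <;> simp [h1]
  have hm' : (m : ℝ) ≠ 0 := Nat.cast_ne_zero.2 hm
  have hind2 : ∀ j, Integrable (fun ω => B.indicator (fun _ => (1 : ℝ)) (x j ω)) μ := fun j => by
    simpa using hind1 univ MeasurableSet.univ j
  have hfi : Integrable (fun ω => (empirical x ω).real B) μ := by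
    simp only [empirical_real x _ hB]
    exact (integrable_finsetSum _ fun j _ => hind2 j).const_mul _
  have hce := ae_eq_condExp_of_forall_setIntegral_eq h𝒢 hfi (fun A _ _ => hgi.integrableOn)
    (fun A hA _ => by
      simp only [empirical_real x _ hB]
      rw [integral_const_mul, integral_finsetSum _ fun j _ => (hind2 j).integrableOn]
      simp only [hset A hA, Finset.sum_const, Finset.card_univ, Fintype.card_fin, nsmul_eq_mul]
      rw [inv_mul_cancel_left₀ hm'])
    hgm.stronglyMeasurable.aestronglyMeasurable
  filter_upwards [hQ.condExp B hB, hce] with ω h1 h2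
  rw [h1, h2]

lemma abs_sub_le_lipSemi_mul_diam [CompactSpace X] {f : X → ℝ} (hf : f ∈ lipClass X) (x y : X) :
    |f x - f y| ≤ lipSemi f * diam X :=
  (abs_sub_le_lipSemi hf x y).trans
    (mul_le_mul_of_nonneg_left (l1Dist_le_diam x y) (lipSemi_nonneg f))

/-- The expected loss of a uniformly sampled prediction is the expected loss under the law of the
perturbed minimizer. -/
lemma integral_sampled_loss [CompactSpace X] [Nonempty X] {η : ℝ} (hη : 0 < η)
    {Ω : Type*} {𝒢 ℳ : MeasurableSpace Ω} [mΩ : MeasurableSpace Ω] {μ : Measure Ω}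
    [IsProbabilityMeasure μ] (h𝒢ℳ : 𝒢 ≤ ℳ) (hℳ : ℳ ≤ mΩ) {m : ℕ} (hm : m ≠ 0)
    {f v : Ω → lipClass X}
    {S : Fin m → Ω → Fin d → ℝ} (hf : Measurable[𝒢] f) (hv : Measurable[𝒢] v)
    (hS : ∀ j, Measurable (S j)) (hlaw : ∀ j, μ.map (S j) = pertLaw d η)
    (hind : ∀ j, Indep (MeasurableSpace.comap (S j) inferInstance) 𝒢 μ)
    {x : Fin m → Ω → X} (hxm : ∀ j, Measurable[ℳ] (x j))
    (hx : ∀ j, ∀ᵐ ω ∂μ, IsPertMin (v ω).1 (S j ω) (x j ω))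
    {J : Ω → Fin m} (hJ : Measurable J) (hJu : ∀ k, μ {ω | J ω = k} = (m : ENNReal)⁻¹)
    (hJi : Indep (MeasurableSpace.comap J inferInstance) ℳ μ)
    (hfi : Integrable (fun ω => lipSemi (f ω).1) μ) (y : X) :
    Integrable (fun ω => (f ω).1 (x (J ω) ω) - (f ω).1 y) μ ∧
      Integrable (fun ω => ∫ z, ((f ω).1 z - (f ω).1 y) ∂(gradLaw η (v ω))) μ ∧
      ∫ ω, ((f ω).1 (x (J ω) ω) - (f ω).1 y) ∂μ =
        ∫ ω, ∫ z, ((f ω).1 z - (f ω).1 y) ∂(gradLaw η (v ω)) ∂μ := by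
  -- Only the seminorm of the loss is assumed integrable, not its values, so differences with a
  -- fixed point y are used throughout.
  have hbound : ∀ {u : Ω → X}, Measurable (fun ω => (f ω).1 (u ω) - (f ω).1 y) →
      Integrable (fun ω => (f ω).1 (u ω) - (f ω).1 y) μ := fun hu =>
    (hfi.mul_const (diam X)).mono' hu.aestronglyMeasurable (Eventually.of_forall fun ω =>
      abs_sub_le_lipSemi_mul_diam (f ω).2 _ _)
  have hφ : Measurable fun p : lipClass X × X => p.1.1 p.2 - p.1.1 y :=
    measurable_eval.sub (measurable_eval.comp (measurable_fst.prodMk measurable_const))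
  have hF : ∀ k, Measurable[ℳ] fun ω => (f ω).1 (x k ω) - (f ω).1 y := fun k =>
    hφ.comp ((hf.mono h𝒢ℳ le_rfl).prodMk (hxm k))
  have hFm : Measurable[ℳ] fun ω k => (f ω).1 (x k ω) - (f ω).1 y :=
    @measurable_pi_lambda _ _ _ ℳ _ _ hF
  have hh : Measurable fun p : (Fin m → ℝ) × Fin m => p.1 p.2 :=
    measurable_from_prod_countable_left fun k => measurable_pi_apply k
  have hJint : Integrable (fun ω => (f ω).1 (x (J ω) ω) - (f ω).1 y) μ :=
    hbound (u := fun ω => x (J ω) ω) (hh.comp ((hFm.mono hℳ le_rfl).prodMk hJ))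
  have hround : ∀ k, _ := fun k => integral_comp_pertMin hη (h𝒢ℳ.trans hℳ) hf hv (hS k) (hlaw k)
    (hind k) (hx k) hφ (hbound ((hF k).mono hℳ le_rfl))
  have hm' : (m : ℝ) ≠ 0 := Nat.cast_ne_zero.2 hm
  have : NeZero m := ⟨hm⟩
  refine ⟨hJint, (hround 0).1, ?_⟩
  have h := (integrable_and_integral_eq_of_indepFun (hFm.mono hℳ le_rfl) hJ
    (indepFun_of_measurable_of_indep hFm (comap_measurable J) hJi) hh hJint).2
  have := Measure.isProbabilityMeasure_map (μ := μ) hJ.aemeasurable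
  have hJr : ∀ k, (μ.map J).real {k} = (m : ℝ)⁻¹ := fun k => by
    rw [measureReal_def, Measure.map_apply hJ (measurableSet_singleton k)]
    change (μ {ω | J ω = k}).toReal = _
    rw [hJu k, ENNReal.toReal_inv, ENNReal.toReal_natCast]
  have e : ∀ ω, ∫ k, ((f ω).1 (x k ω) - (f ω).1 y) ∂(μ.map J) =
      (m : ℝ)⁻¹ * ∑ k, ((f ω).1 (x k ω) - (f ω).1 y) := fun ω => by
    rw [integral_fintype Integrable.of_finite, Finset.mul_sum]
    simp only [hJr, smul_eq_mul]
  simp only [e] at h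
  rw [h, integral_const_mul, integral_finsetSum _ fun k _ => hbound ((hF k).mono hℳ le_rfl),
    Finset.sum_congr rfl fun k _ => (hround k).2]
  simp only [Finset.sum_const, Finset.card_univ, Fintype.card_fin, nsmul_eq_mul]
  rw [inv_mul_cancel_left₀ hm']

end Round

/-! ### Telescoping and the regret bound -/

section Regret

open Set Filter Topology

variable {d : ℕ} {X : Set (Fin d → ℝ)}

open Classical in
/-- A function on `X` as an element of `lipClass X`, with the value `0` outside of the class. -/
noncomputable def toLip (f : X → ℝ) : lipClass X :=
  if h : f ∈ lipClass X then ⟨f, h⟩ else ⟨0, zero_mem_lipClass⟩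

lemma toLip_val {f : X → ℝ} (hf : f ∈ lipClass X) : (toLip f).1 = f := by
  simp [toLip, hf]

lemma measurable_toLip {Ω : Type*} {m : MeasurableSpace Ω} {f : Ω → X → ℝ} (hf : Measurable f)
    (h : ∀ ω, f ω ∈ lipClass X) : Measurable fun ω => toLip (f ω) := by
  have e : (fun ω => toLip (f ω)) = fun ω => (⟨f ω, h ω⟩ : lipClass X) :=
    funext fun ω => Subtype.ext (toLip_val (h ω))
  rw [e]
  exact hf.subtype_mk

lemma pastLoss_succ {Ω E : Type*} (f : ℕ → Ω → E → ℝ) {t : ℕ} (ht : 1 ≤ t) (ω : Ω) :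
    pastLoss f (t + 1) ω = pastLoss f t ω + f t ω := by
  ext x
  simp [pastLoss, Finset.sum_Ico_succ_top ht]

lemma pastLoss_mem_lipClass {Ω : Type*} {f : ℕ → Ω → X → ℝ} {T : ℕ} {ω : Ω}
    (hf : ∀ t ∈ Finset.Icc 1 T, f t ω ∈ lipClass X) {t : ℕ} (ht : t ≤ T + 1) :
    pastLoss f t ω ∈ lipClass X := by
  induction t with
  | zero => convert zero_mem_lipClass (X := X); ext x; simp [pastLoss]
  | succ t ih =>
    rcases Nat.eq_zero_or_pos t with rfl | h1
    · convert zero_mem_lipClass (X := X); ext x; simp [pastLoss]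
    · rw [pastLoss_succ f h1]
      exact add_mem_lipClass (ih (by omega)) (hf t (Finset.mem_Icc.2 ⟨h1, by omega⟩))

lemma measurable_pastLoss {Ω E : Type*} [MeasurableSpace E] {f : ℕ → Ω → E → ℝ}
    (P : ℕ → Ω → Measure E) (t : ℕ) : Measurable[pastSigma f P t] (pastLoss f t) := by
  refine @measurable_pi_lambda _ _ _ (pastSigma f P t) _ _ fun y => ?_
  refine Finset.measurable_sum _ fun s hs => (measurable_pi_apply y).comp ?_
  refine (comap_measurable (f s)).mono ?_ le_rfl
  exact le_sup_left.trans (le_iSup₂_of_le s hs le_rfl)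

lemma sum_Icc_sub_succ (a : ℕ → ℝ) (T : ℕ) :
    ∑ t ∈ Finset.Icc 1 T, (a t - a (t + 1)) = a 1 - a (T + 1) := by
  induction T with
  | zero => simp
  | succ n ih => rw [Finset.sum_Icc_succ_top (by omega), ih]; ring

lemma IsRun.pastSigma_le {η : ℝ} {m T : ℕ} {Ω : Type*} [mΩ : MeasurableSpace Ω]
    {μ : Measure Ω} {ℋ : Filtration ℕ mΩ} {f g : ℕ → Ω → X → ℝ}
    {σ : ℕ → Fin m → Ω → Fin d → ℝ} {x : ℕ → Fin m → Ω → X} {J : ℕ → Ω → Fin m}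
    (h : IsRun X η m T μ ℋ f g σ x J) {t : ℕ} (ht : t ∈ Finset.Icc 1 T) :
    pastSigma f (fun s => empirical (x s)) t ≤ ℋ t := by
  refine iSup₂_le fun s hs => ?_
  have hs' := Finset.mem_Ico.1 hs
  have hsT : s ∈ Finset.Icc 1 T := Finset.mem_Icc.2 ⟨hs'.1, hs'.2.le.trans (Finset.mem_Icc.1 ht).2⟩
  refine sup_le ?_ ?_
  · exact (h.loss_meas s hsT).comap_le.trans (ℋ.mono hs'.2.le)
  · exact (measurable_empirical (h.pred_meas s hsT)).comap_le.trans (ℋ.mono hs'.2)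

/-- A pathwise bound: the one-round inequalities telescope from potential 0, and the comparator's
total loss cancels the one produced by `neg_pot_le`. -/
lemma integral_gradLaw_sub_le [CompactSpace X] [Nonempty X] {η β : ℝ} {T : ℕ} {Ω : Type*}
    {f g : ℕ → Ω → X → ℝ} (hη : 0 < η) (hβ0 : 0 ≤ β) (hβ : ∀ u v : lipClass X,
      ipm (gradLaw η u) (gradLaw η v) ≤ β * lipSemi (u.1 - v.1)) {ω : Ω}
    (hf : ∀ t ∈ Finset.Icc 1 T, f t ω ∈ lipClass X)
    (hg : ∀ t ∈ Finset.Icc 1 T, g t ω ∈ lipClass X) (y : X) :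
    ∑ t ∈ Finset.Icc 1 T,
        ∫ z, (f t ω z - f t ω y) ∂(gradLaw η (toLip (pastLoss f t ω + g t ω))) ≤
      diam X * ∫ s, lipSemi (linPert X s) ∂(pertLaw d η) +
        ∑ t ∈ Finset.Icc 1 T, (β * lipSemi (f t ω - g t ω) ^ 2 - (4 * β)⁻¹ *
          ipm (gradLaw η (toLip (pastLoss f t ω + g t ω)))
            (gradLaw η (toLip (pastLoss f t ω))) ^ 2) := by
  have hp : ∀ t, t ≤ T + 1 → pastLoss f t ω ∈ lipClass X := fun t ht =>
    pastLoss_mem_lipClass hf ht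
  have hround : ∀ t ∈ Finset.Icc 1 T,
      ∫ z, (f t ω z - f t ω y) ∂(gradLaw η (toLip (pastLoss f t ω + g t ω))) ≤
        (pot η (pastLoss f t ω) - pot η (pastLoss f (t + 1) ω)) +
        (β * lipSemi (f t ω - g t ω) ^ 2 - (4 * β)⁻¹ *
          ipm (gradLaw η (toLip (pastLoss f t ω + g t ω)))
            (gradLaw η (toLip (pastLoss f t ω))) ^ 2) - f t ω y := by
    intro t ht
    have htT := Finset.mem_Icc.1 ht
    have hpt := hp t (by omega)
    have hw := add_mem_lipClass hpt (hf t ht)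
    have hv := add_mem_lipClass hpt (hg t ht)
    have := isProbabilityMeasure_gradLaw hη (toLip (pastLoss f t ω + g t ω))
    have h := integral_gradLaw_le hη hβ0 hβ (toLip (f t ω)) (toLip (g t ω))
      (toLip (pastLoss f t ω)) (toLip (pastLoss f t ω + g t ω))
      (toLip (pastLoss f (t + 1) ω))
      (by rw [toLip_val hv, toLip_val hpt, toLip_val (hg t ht)])
      (by rw [pastLoss_succ f htT.1, toLip_val hw, toLip_val hpt, toLip_val (hf t ht)])
    rw [toLip_val (hf t ht), toLip_val (hg t ht), toLip_val hpt,
      toLip_val (hp (t + 1) (by omega))] at h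
    rw [integral_sub (integrable_of_mem_lipClass (hf t ht) _) (integrable_const _),
      integral_const, probReal_univ, one_smul]
    linarith
  refine (Finset.sum_le_sum hround).trans ?_
  rw [Finset.sum_sub_distrib, Finset.sum_add_distrib,
    sum_Icc_sub_succ fun t => pot η (pastLoss f t ω)]
  have h1 : pastLoss f 1 ω = 0 := by ext z; simp [pastLoss]
  have h2 : ∑ t ∈ Finset.Icc 1 T, f t ω y = pastLoss f (T + 1) ω y := by
    simp only [pastLoss]
    refine Finset.sum_congr ?_ fun _ _ => rfl
    ext; simp
  have h3 := neg_pot_le hη (toLip (pastLoss f (T + 1) ω)) y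
  rw [toLip_val (hp (T + 1) le_rfl)] at h3
  rw [h1, h2, pot_zero]
  linarith

/-- A conditional expectation of the empirical distribution of perturbed minimizers is the law of
the perturbed minimizer. -/
lemma IsRun.ae_eq_gradLaw [CompactSpace X] [Nonempty X] {η : ℝ} {m T : ℕ} {Ω : Type*}
    {𝒢 : MeasurableSpace Ω} [mΩ : MeasurableSpace Ω] {μ : Measure Ω} [IsProbabilityMeasure μ]
    {ℋ : Filtration ℕ mΩ} {f g : ℕ → Ω → X → ℝ} {σ : ℕ → Fin m → Ω → Fin d → ℝ}
    {x : ℕ → Fin m → Ω → X} {J : ℕ → Ω → Fin m} (hη : 0 < η) (h : IsRun X η m T μ ℋ f g σ x J) {t : ℕ}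
    (ht : t ∈ Finset.Icc 1 T) (h𝒢 : 𝒢 ≤ ℋ t) (hm : m ≠ 0)
    {v : Ω → X → ℝ} (hvL : ∀ ω, v ω ∈ lipClass X) (hv : Measurable[𝒢] v)
    {z : Fin m → Ω → X} (hzm : ∀ j, Measurable (z j))
    (hz : ∀ j, ∀ᵐ ω ∂μ, IsPertMin (v ω) (σ t j ω) (z j ω)) {Q : Ω → Measure X}
    (hQ : IsCondExpMeasure μ 𝒢 (empirical z) Q) :
    ∀ᵐ ω ∂μ, Q ω = gradLaw η (toLip (v ω)) := by
  refine hQ.ae_eq_gradLaw hη (h𝒢.trans (ℋ.le t)) hm (measurable_toLip hv hvL)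
    (fun j => (h.pert_meas t ht j).mono (ℋ.le _) le_rfl) (h.pert_law t ht) (fun j => ?_) hzm
    (fun j => ?_)
  · exact indep_of_indep_of_le_left (indep_of_indep_of_le_right (h.pert_indep t ht) h𝒢)
      (le_iSup (fun j => MeasurableSpace.comap (σ t j) inferInstance) j)
  · filter_upwards [hz j] with ω hω
    rwa [toLip_val (hvL ω)]

section Run

variable [CompactSpace X] [Nonempty X] {η : ℝ} {m T : ℕ} {Ω : Type*} [mΩ : MeasurableSpace Ω]
  {μ : Measure Ω} [IsProbabilityMeasure μ] {ℋ : Filtration ℕ mΩ} {f g : ℕ → Ω → X → ℝ}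
  {σ : ℕ → Fin m → Ω → Fin d → ℝ} {x x' : ℕ → Fin m → Ω → X} {J : ℕ → Ω → Fin m}
  {Pinf P'inf : ℕ → Ω → Measure X}

lemma IsRun.integral_loss (hη : 0 < η) (h : IsRun X η m T μ ℋ f g σ x J) {t : ℕ}
    (ht : t ∈ Finset.Icc 1 T) (hm : m ≠ 0)
    (hfi : Integrable (fun ω => lipSemi (f t ω)) μ) (y : X) :
    Integrable (fun ω => f t ω (x t (J t ω) ω) - f t ω y) μ ∧
      Integrable (fun ω => ∫ z, (f t ω z - f t ω y)
        ∂(gradLaw η (toLip (pastLoss f t ω + g t ω)))) μ ∧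
      ∫ ω, (f t ω (x t (J t ω) ω) - f t ω y) ∂μ =
        ∫ ω, ∫ z, (f t ω z - f t ω y) ∂(gradLaw η (toLip (pastLoss f t ω + g t ω))) ∂μ := by
  have htT := Finset.mem_Icc.1 ht
  have hpL : ∀ ω, pastLoss f t ω + g t ω ∈ lipClass X := fun ω =>
    add_mem_lipClass (pastLoss_mem_lipClass (fun s hs => h.loss_mem s hs ω) (by omega))
      (h.guess_mem t ht ω)
  have hpm : Measurable[ℋ t] fun ω => pastLoss f t ω + g t ω :=
    ((measurable_pastLoss (fun s => empirical (x s)) t).mono (h.pastSigma_le ht) le_rfl).add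
      (h.guess_meas t ht)
  have hj : ∀ j, MeasurableSpace.comap (σ t j) inferInstance ⊔
      MeasurableSpace.comap (x t j) inferInstance ≤ ℋ (t + 1) := fun j =>
    sup_le (h.pert_meas t ht j).comap_le (h.pred_meas t ht j).comap_le
  have key := integral_sampled_loss hη (𝒢 := ℋ t)
    (ℳ := ℋ t ⊔ ⨆ j, (MeasurableSpace.comap (σ t j) inferInstance ⊔
      MeasurableSpace.comap (x t j) inferInstance)) le_sup_left
    (sup_le (ℋ.le t) (iSup_le fun j => (hj j).trans (ℋ.le _))) hm
    (f := fun ω => toLip (f t ω)) (v := fun ω => toLip (pastLoss f t ω + g t ω)) (S := σ t)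
    (measurable_toLip (h.loss_meas t ht) (h.loss_mem t ht)) (measurable_toLip hpm hpL)
    (fun j => (h.pert_meas t ht j).mono (ℋ.le _) le_rfl) (h.pert_law t ht)
    (fun j => indep_of_indep_of_le_left (h.pert_indep t ht)
      (le_iSup (fun j => MeasurableSpace.comap (σ t j) inferInstance) j))
    (x := x t) (fun j => (comap_measurable (x t j)).mono (le_sup_of_le_right
      (le_iSup_of_le j le_sup_right)) le_rfl)
    (fun j => by
      filter_upwards [h.pred_min t ht j] with ω hω
      rwa [toLip_val (hpL ω)])
    ((h.index_meas t ht).mono (ℋ.le _) le_rfl) (h.index_unif t ht) (h.index_indep t ht)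
    (by simpa only [toLip_val (h.loss_mem t ht _)] using hfi) y
  simpa only [toLip_val (h.loss_mem t ht _)] using key

/-- The regret bound of optimistic follow-the-perturbed-leader in terms of the smoothness constant
`β` of the expected perturbed maximum. -/
lemma IsRun.regret_le {β : ℝ} (hη : 0 < η) (hβ0 : 0 ≤ β) (hβ : ∀ u v : lipClass X,
      ipm (gradLaw η u) (gradLaw η v) ≤ β * lipSemi (u.1 - v.1))
    (h : IsRun X η m T μ ℋ f g σ x J)
    (hx' : ∀ t ∈ Finset.Icc 1 T, ∀ j, Measurable (x' t j) ∧
      ∀ᵐ ω ∂μ, IsPertMin (pastLoss f t ω) (σ t j ω) (x' t j ω))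
    (hP : ∀ t ∈ Finset.Icc 1 T, IsCondExpMeasure μ
      (MeasurableSpace.comap (g t) inferInstance ⊔ pastSigma f (fun s => empirical (x s)) t)
      (empirical (x t)) (Pinf t))
    (hP' : ∀ t ∈ Finset.Icc 1 T, IsCondExpMeasure μ
      (pastSigma f (fun s => empirical (x s)) t) (empirical (x' t)) (P'inf (t - 1)))
    (hfi : ∀ t ∈ Finset.Icc 1 T, Integrable (fun ω => lipSemi (f t ω)) μ)
    (hfg : ∀ t ∈ Finset.Icc 1 T, Integrable (fun ω => lipSemi (f t ω - g t ω) ^ 2) μ) :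
    (∀ t ∈ Finset.Icc 1 T, Integrable (fun ω => ipm (Pinf t ω) (P'inf (t - 1) ω) ^ 2) μ) ∧
    ∀ y : X, Integrable (fun ω => ∑ t ∈ Finset.Icc 1 T, (f t ω (x t (J t ω) ω) - f t ω y)) μ ∧
      ∫ ω, ∑ t ∈ Finset.Icc 1 T, (f t ω (x t (J t ω) ω) - f t ω y) ∂μ ≤
        diam X * ∫ s, lipSemi (linPert X s) ∂(pertLaw d η) +
          ∑ t ∈ Finset.Icc 1 T, β * ∫ ω, lipSemi (f t ω - g t ω) ^ 2 ∂μ -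
          ∑ t ∈ Finset.Icc 1 T, (4 * β)⁻¹ * ∫ ω, ipm (Pinf t ω) (P'inf (t - 1) ω) ^ 2 ∂μ := by
  -- The sampled index takes values in `Fin m` on a nonempty space.
  have hm : m ≠ 0 := by
    rintro rfl
    obtain ⟨ω⟩ : Nonempty Ω := μ.nonempty_of_neZero
    exact (J 0 ω).elim0
  have hp : ∀ t ∈ Finset.Icc 1 T, ∀ ω, pastLoss f t ω ∈ lipClass X := fun t ht ω => by
    have htT := Finset.mem_Icc.1 ht
    exact pastLoss_mem_lipClass (fun s hs => h.loss_mem s hs ω) (by omega)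
  have hpg : ∀ t ∈ Finset.Icc 1 T, ∀ ω, pastLoss f t ω + g t ω ∈ lipClass X := fun t ht ω =>
    add_mem_lipClass (hp t ht ω) (h.guess_mem t ht ω)
  have hpm := measurable_pastLoss (f := f) (fun s => empirical (x s))
  have hpgm : ∀ t, Measurable[MeasurableSpace.comap (g t) inferInstance ⊔
      pastSigma f (fun s => empirical (x s)) t] fun ω => pastLoss f t ω + g t ω := fun t =>
    ((hpm t).mono le_sup_right le_rfl).add ((comap_measurable (g t)).mono le_sup_left le_rfl)
  have hle : ∀ t ∈ Finset.Icc 1 T, MeasurableSpace.comap (g t) inferInstance ⊔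
      pastSigma f (fun s => empirical (x s)) t ≤ ℋ t := fun t ht =>
    sup_le (h.guess_meas t ht).comap_le (h.pastSigma_le ht)
  set G : ℕ → Ω → ℝ := fun t ω => ipm (gradLaw η (toLip (pastLoss f t ω + g t ω)))
    (gradLaw η (toLip (pastLoss f t ω))) ^ 2
  have hG : ∀ t ∈ Finset.Icc 1 T, Integrable (G t) μ := fun t ht => by
    have hmeas : Measurable (G t) :=
      ((measurable_ipm_gradLaw hη).comp
        (((measurable_toLip (hpgm t) (hpg t ht)).mono ((hle t ht).trans (ℋ.le t)) le_rfl).prodMk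
        ((measurable_toLip (hpm t) (hp t ht)).mono ((h.pastSigma_le ht).trans (ℋ.le t))
          le_rfl))).pow_const 2
    refine Integrable.of_bound hmeas.aestronglyMeasurable (diam X ^ 2)
      (Eventually.of_forall fun ω => ?_)
    have := isProbabilityMeasure_gradLaw hη (toLip (pastLoss f t ω + g t ω))
    have := isProbabilityMeasure_gradLaw hη (toLip (pastLoss f t ω))
    rw [Real.norm_of_nonneg (sq_nonneg _)]
    exact pow_le_pow_left₀ (ipm_nonneg _ _) (ipm_le_diam _ _) 2
  have hGae : ∀ t ∈ Finset.Icc 1 T,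
      G t =ᵐ[μ] fun ω => ipm (Pinf t ω) (P'inf (t - 1) ω) ^ 2 := fun t ht => by
    have e1 := h.ae_eq_gradLaw hη ht (hle t ht) hm (hpg t ht) (hpgm t)
      (fun j => (h.pred_meas t ht j).mono (ℋ.le _) le_rfl) (h.pred_min t ht) (hP t ht)
    have e2 := h.ae_eq_gradLaw hη ht (h.pastSigma_le ht) hm (hp t ht) (hpm t)
      (fun j => (hx' t ht j).1) (fun j => (hx' t ht j).2) (hP' t ht)
    filter_upwards [e1, e2] with ω h1 h2
    rw [h1, h2]
  refine ⟨fun t ht => (hG t ht).congr (hGae t ht), fun y => ?_⟩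
  have hloss := fun t ht => h.integral_loss hη ht hm (hfi t ht) y
  refine ⟨integrable_finsetSum _ fun t ht => (hloss t ht).1, ?_⟩
  have hint : ∀ t ∈ Finset.Icc 1 T,
      Integrable (fun ω => β * lipSemi (f t ω - g t ω) ^ 2 - (4 * β)⁻¹ * G t ω) μ := fun t ht =>
    ((hfg t ht).const_mul β).sub ((hG t ht).const_mul _)
  rw [integral_finsetSum _ fun t ht => (hloss t ht).1,
    Finset.sum_congr rfl fun t ht => (hloss t ht).2.2,
    ← integral_finsetSum _ fun t ht => (hloss t ht).2.1]
  refine (integral_mono (integrable_finsetSum _ fun t ht => (hloss t ht).2.1)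
    ((integrable_const _).add (integrable_finsetSum _ hint)) fun ω =>
    integral_gradLaw_sub_le hη hβ0 hβ (fun t ht => h.loss_mem t ht ω)
      (fun t ht => h.guess_mem t ht ω) y).trans (le_of_eq ?_)
  simp only [Pi.add_apply]
  rw [integral_add (integrable_const _) (integrable_finsetSum _ hint), integral_const,
    probReal_univ, one_smul, integral_finsetSum _ hint, add_sub_assoc, ← Finset.sum_sub_distrib]
  congr 1
  refine Finset.sum_congr rfl fun t ht => ?_
  rw [integral_sub ((hfg t ht).const_mul β) ((hG t ht).const_mul _), integral_const_mul,
    integral_const_mul, integral_congr_ae (hGae t ht)]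

end Run

end Regret

end OFTPL

/-! ### The main theorem -/

theorem mainTheorem8 :
    ∃ C c₁ c₂ c₃ : ℝ, 0 < C ∧ 0 < c₁ ∧ 0 < c₂ ∧ 0 < c₃ ∧
    ∀ (d : ℕ) (X : Set (Fin d → ℝ)) (η : ℝ), 1 ≤ d → IsCompact X → X.Nonempty → 0 < η →
      -- the perturbed minimizer is almost surely unique, and it is a random variable
      (∀ f ∈ OFTPL.lipClass X,
        (∀ᵐ s ∂(OFTPL.pertLaw d η), ∃! x : X, OFTPL.IsPertMin f s x) ∧
        ∃ xf : (Fin d → ℝ) → X, OFTPL.IsPertArgmin η f xf) ∧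
      -- the expected seminorm of the perturbation
      (Integrable (fun s => OFTPL.lipSemi (OFTPL.linPert X s)) (OFTPL.pertLaw d η) ∧
        ∫ s, OFTPL.lipSemi (OFTPL.linPert X s) ∂(OFTPL.pertLaw d η)
          ≤ η * ∑ k ∈ Finset.Icc 1 d, (1 : ℝ) / k ∧
        ((∀ i : Fin d, ∃ x ∈ X, ∃ y ∈ X, x ≠ y ∧ ∀ k, k ≠ i → x k = y k) →
          ∫ s, OFTPL.lipSemi (OFTPL.linPert X s) ∂(OFTPL.pertLaw d η)
            = η * ∑ k ∈ Finset.Icc 1 d, (1 : ℝ) / k) ∧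
        Real.log d ≤ ∑ k ∈ Finset.Icc 1 d, (1 : ℝ) / k ∧
        ∑ k ∈ Finset.Icc 1 d, (1 : ℝ) / k ≤ 1 + Real.log d) ∧
      -- stability of the predictions
      OFTPL.IsStable X η (C * ((d : ℝ) ^ 2 * OFTPL.diam X / η)) ∧
      -- the regret bound
      ∀ (m T : ℕ) {Ω : Type*} [mΩ : MeasurableSpace Ω] (μ : Measure Ω) [IsProbabilityMeasure μ]
        (ℋ : Filtration ℕ mΩ) (f g : ℕ → Ω → X → ℝ) (σ : ℕ → Fin m → Ω → Fin d → ℝ)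
        (x x' : ℕ → Fin m → Ω → X) (J : ℕ → Ω → Fin m) (Pinf P'inf : ℕ → Ω → Measure X),
        OFTPL.IsRun X η m T μ ℋ f g σ x J →
        -- `x'` are the predictions of round `t` if the guess `0` was used
        (∀ t ∈ Finset.Icc 1 T, ∀ j, Measurable (x' t j) ∧
          ∀ᵐ ω ∂μ, OFTPL.IsPertMin (OFTPL.pastLoss f t ω) (σ t j ω) (x' t j ω)) →
        -- `Pinf t` is `E[P_t | g_t, f_{1:t-1}, P_{1:t-1}]`
        (∀ t ∈ Finset.Icc 1 T, OFTPL.IsCondExpMeasure μ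
          (MeasurableSpace.comap (g t) inferInstance ⊔
            OFTPL.pastSigma f (fun s => OFTPL.empirical (x s)) t)
          (OFTPL.empirical (x t)) (Pinf t)) →
        -- `P'inf (t - 1)` is `E[P'_{t-1} | f_{1:t-1}, P_{1:t-1}]`, with `P'_{t-1}` the empirical
        -- distribution of round `t` if the guess `0` was used
        (∀ t ∈ Finset.Icc 1 T, OFTPL.IsCondExpMeasure μ
          (OFTPL.pastSigma f (fun s => OFTPL.empirical (x s)) t)
          (OFTPL.empirical (x' t)) (P'inf (t - 1))) →
        (∀ t ∈ Finset.Icc 1 T, Integrable (fun ω => OFTPL.lipSemi (f t ω)) μ) →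
        (∀ t ∈ Finset.Icc 1 T, Integrable (fun ω => OFTPL.lipSemi (f t ω - g t ω) ^ 2) μ) →
        (∀ t ∈ Finset.Icc 1 T,
          Integrable (fun ω => OFTPL.ipm (Pinf t ω) (P'inf (t - 1) ω) ^ 2) μ) ∧
        ∀ y : X,
          Integrable (fun ω => ∑ t ∈ Finset.Icc 1 T, (f t ω (x t (J t ω) ω) - f t ω y)) μ ∧
          ∫ ω, ∑ t ∈ Finset.Icc 1 T, (f t ω (x t (J t ω) ω) - f t ω y) ∂μ
            ≤ c₁ * (η * OFTPL.diam X * (1 + Real.log d))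
              + c₂ * ∑ t ∈ Finset.Icc 1 T, (d : ℝ) ^ 2 * OFTPL.diam X / η *
                  ∫ ω, OFTPL.lipSemi (f t ω - g t ω) ^ 2 ∂μ
              - c₃ * ∑ t ∈ Finset.Icc 1 T, η / ((d : ℝ) ^ 2 * OFTPL.diam X) *
                  ∫ ω, OFTPL.ipm (Pinf t ω) (P'inf (t - 1) ω) ^ 2 ∂μ ∧
          (2 ≤ d →
            ∫ ω, ∑ t ∈ Finset.Icc 1 T, (f t ω (x t (J t ω) ω) - f t ω y) ∂μ
              ≤ c₁ * (η * OFTPL.diam X * Real.log d)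
                + c₂ * ∑ t ∈ Finset.Icc 1 T, (d : ℝ) ^ 2 * OFTPL.diam X / η *
                    ∫ ω, OFTPL.lipSemi (f t ω - g t ω) ^ 2 ∂μ
                - c₃ * ∑ t ∈ Finset.Icc 1 T, η / ((d : ℝ) ^ 2 * OFTPL.diam X) *
                    ∫ ω, OFTPL.ipm (Pinf t ω) (P'inf (t - 1) ω) ^ 2 ∂μ) := by
  -- The stability constant β = 4d²D/η gives the two 4s, and 1/(4β) gives 1/16. The 3 serves only d
  -- ≥ 2, where log d ≥ log 2 > 1/2 yields 1 + log d ≤ 3 log d.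
  refine ⟨4, 3, 4, 1 / 16, by norm_num, by norm_num, by norm_num, by norm_num, ?_⟩
  intro d X η hd hX hne hη
  have hXc : CompactSpace X := isCompact_iff_compactSpace.1 hX
  have hXn : Nonempty X := hne.to_subtype
  have hD := OFTPL.diam_nonneg (X := X)
  have hH := OFTPL.integral_lipSemi_linPert_le X hη
  have hH1 := OFTPL.sum_one_div_le_one_add_log d
  have hlog : 0 ≤ Real.log d := Real.log_natCast_nonneg d
  refine ⟨fun f hf => ⟨?_, _, OFTPL.isPertArgmin_pertArgmin hη ⟨f, hf⟩⟩,
    ⟨OFTPL.integrable_lipSemi_linPert X hη, hH, fun h => ?_, OFTPL.log_le_sum_one_div hd, hH1⟩,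
    OFTPL.isStable hη, ?_⟩
  · filter_upwards [OFTPL.ae_isPertMin_iff hη ⟨f, hf⟩] with s hs
    exact ⟨_, (hs _).2 rfl, fun y hy => (hs y).1 hy⟩
  · simp only [OFTPL.lipSemi_linPert_eq h]
    exact OFTPL.integral_norm_pertLaw d hη
  · intro m T Ω mΩ μ hμ ℋ f g σ x x' J Pinf P'inf hrun hx' hP hP' hfi hfg
    obtain ⟨h1, h2⟩ := hrun.regret_le (β := 4 * ((d : ℝ) ^ 2 * OFTPL.diam X / η)) hη
      (by positivity) (OFTPL.ipm_gradLaw_le hη) hx' hP hP' hfi hfg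
    refine ⟨h1, fun y => ⟨(h2 y).1, ?_⟩⟩
    have h3 := (h2 y).2
    have e1 : ∀ a : ℕ → ℝ, ∑ t ∈ Finset.Icc 1 T, 4 * ((d : ℝ) ^ 2 * OFTPL.diam X / η) * a t =
        4 * ∑ t ∈ Finset.Icc 1 T, (d : ℝ) ^ 2 * OFTPL.diam X / η * a t := fun a => by
      simp only [Finset.mul_sum, mul_assoc]
    -- For D = 0 both sides vanish, since division by zero is 0; this is the stated reading of the
    -- last sum.
    have e2 : ∀ a : ℕ → ℝ, ∑ t ∈ Finset.Icc 1 T,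
        (4 * (4 * ((d : ℝ) ^ 2 * OFTPL.diam X / η)))⁻¹ * a t =
        1 / 16 * ∑ t ∈ Finset.Icc 1 T, η / ((d : ℝ) ^ 2 * OFTPL.diam X) * a t := fun a => by
      rw [Finset.mul_sum]
      refine Finset.sum_congr rfl fun t _ => ?_
      rw [← mul_assoc, mul_inv, mul_inv, inv_div]
      ring
    rw [e1, e2] at h3
    have h4 := mul_le_mul_of_nonneg_left hH hD
    have hηD : 0 ≤ η * OFTPL.diam X := mul_nonneg hη.le hD
    have h5 := mul_le_mul_of_nonneg_left hH1 hηD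
    constructor
    · have h6 : 0 ≤ η * OFTPL.diam X * (1 + Real.log d) := mul_nonneg hηD (by linarith)
      linarith
    · intro hd2
      have h7 : Real.log 2 ≤ Real.log d :=
        Real.log_le_log (by norm_num) (by exact_mod_cast hd2)
      have h8 : 1 + Real.log d ≤ 3 * Real.log d := by linarith [Real.log_two_gt_d9]
      have h9 := mul_le_mul_of_nonneg_left h8 hηD
      linarith
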